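/- Let $\mathcal V$ be a normal virtual bicategory, i.e. a virtual double category whose only tight-cells are identities and in which every object $V$ admits a loose-identity. A $\mathcal V$-category $\mathbf A$ has a class of objects, each object $x$ having an extent $|x| \in \mathcal V$, hom-morphisms $\mathbf A(x,y) \colon |y| \to |x|$ (loose-cells of $\mathcal V$), and identity and composition 2-cells satisfying the unit and associativity laws; $\mathcal V$-functors preserve extents strictly. A $\mathcal V$-distributor $p \colon \mathbf B \nrightarrow \mathbf A$ has loose-cells $p(a,b) \colon |b| \to |a|$ with compatible actions of $\mathbf A$ on the left and of $\mathbf B$ on the right; $p(1,f)$ denotes its restriction along a $\mathcal V$-functor $f \colon \mathbf X \to \mathbf B$, given by $p(1,f)(a,x) = p(a,fx)$, and $\mathbf A(1,1) \colon \mathbf A \nrightarrow \mathbf A$ is the identity $\mathcal V$-distributor. A 2-cell $p_1, \dots, p_n \Rightarrow q$ of $\mathcal V$-distributors is a $\mathcal V$-natural transformation. $\mathcal V$-categories may be large: their objects, and the objects, loose-cells and 2-cells of $\mathcal V$, form classes, i.e. elements of one fixed universe. For $V \in \mathcal V$, let $\star_V$ be the $\mathcal V$-category with a single object, of extent $V$,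 whose hom-morphism is the loose-identity on $V$. A $\mathcal V$-presheaf on $\mathbf A$ (of extent $V$) is a $\mathcal V$-distributor $\star_V \nrightarrow \mathbf A$; for $p \colon \mathbf B \nrightarrow \mathbf A$ and an object $b$ of $\mathbf B$, the $\mathcal V$-presheaf $p(1,b)$ is the restriction of $p$ along the $\mathcal V$-functor $\star_{|b|} \to \mathbf B$ choosing $b$. For $\mathcal V$-distributors $p \colon \mathbf B \nrightarrow \mathbf A$ and $q \colon \mathbf C \nrightarrow \mathbf A$, a right lift of $q$ through $p$ is a $\mathcal V$-distributor $q \blacktriangleleft p \colon \mathbf C \nrightarrow \mathbf B$ with a 2-cell $\varpi \colon p, q \blacktriangleleft p \Rightarrow q$ through which every 2-cell $p, r_1, \dots, r_n \Rightarrow q$ ($n \ge 0$) factors by a unique 2-cell $r_1, \dots, r_n \Rightarrow q \blacktriangleleft p$. A $\mathcal V$-distributor $p \colon \mathbf B \nrightarrow \mathbf A$ is dense if the identity of $p$ (viewed as the action 2-cell $p, \mathbf B(1,1) \Rightarrow p$) exhibits $\mathbf B(1,1)$ as the right lift $p \blacktriangleleft p$. Let $\mathcal P$ be a class of $\mathcal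 V$-distributors. It is presheaf-induced if a $\mathcal V$-distributor $p \colon \mathbf B \nrightarrow \mathbf A$ is in $\mathcal P$ if and only if $p(1,b)$ is in $\mathcal P$ for every object $b$ of $\mathbf B$. Its repletion is its closure under isomorphism of $\mathcal V$-distributors. A $\mathcal P$-presheaf $\mathcal V$-category for $\mathbf A$ is a $\mathcal V$-category $\mathbf Q$ with a dense $\mathcal V$-distributor $\pi \colon \mathbf Q \nrightarrow \mathbf A$ such that (1) for every $p \colon \mathbf X \nrightarrow \mathbf A$ in $\mathcal P$ there is a unique $\mathcal V$-functor $f \colon \mathbf X \to \mathbf Q$ with $p = \pi(1,f)$, and (2) $\pi(1,f)$ is in $\mathcal P$ for every $\mathcal V$-functor $f \colon \mathbf X \to \mathbf Q$. The $\mathcal V$-category $\mathbf A$ is $\mathcal P$-admissible if it has a $\mathcal P$-presheaf $\mathcal V$-category and the repletion of $\mathcal P$ contains $\mathbf A(1,1)$. **Theorem.** Let $\mathcal P$ be a presheaf-induced class of $\mathcal V$-distributors and let $\mathbf A$ be a $\mathcal V$-category. Then $\mathbf A$ has a $\mathcal P$-presheaf $\mathcal V$-category if and only if the right lift $q \blacktriangleleft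 p$ exists for all $\mathcal V$-presheaves $p, q$ on $\mathbf A$ that are in $\mathcal P$. In this case, $\mathbf A$ is $\mathcal P$-admissible if and only if the repletion of $\mathcal P$ contains the identity $\mathcal V$-distributor $\mathbf A(1,1)$. -/

import Mathlib

universe u w v t

/-! ### Chains of composable arrows -/

/-- Finite chains of composable arrows of a graph, read from left to right. -/
inductive LPath {O : Type w} (L : O → O → Type v) : O → O → Type (max w v)
  | nil (a : O) : LPath L a a
  | cons {a b c : O} (q : L a b) (r : LPath L b c) : LPath L a c

namespace LPath

variable {O : Type w} {L : O → O → Type v}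

/-- Concatenation of chains. -/
def append : {a b c : O} → LPath L a b → LPath L b c → LPath L a c
  | _, _, _, nil _, r => r
  | _, _, _, cons q l, r => cons q (append l r)

/-- The chain consisting of a single arrow. -/
abbrev one {a b : O} (q : L a b) : LPath L a b := cons q (nil b)

end LPath

infixr:67 " ::: " => LPath.cons
infixr:65 " +++ " => LPath.append

namespace LPath

variable {O : Type w} {L : O → O → Type v}

@[simp] theorem nil_append {a b : O} (r : LPath L a b) : nil a +++ r = r := rfl

@[simp] theorem cons_append {a b c d : O} (q : L a b) (l : LPath L b c) (r : LPath L c d) :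
    (q ::: l) +++ r = q ::: (l +++ r) := rfl

@[simp] theorem append_nil {a b : O} (r : LPath L a b) : r +++ nil b = r := by
  induction r with
  | nil _ => rfl
  | cons q r ih => simp [ih]

@[simp] theorem append_assoc {a b c d : O} (l : LPath L a b) (m : LPath L b c)
    (r : LPath L c d) : (l +++ m) +++ r = l +++ (m +++ r) := by
  induction l with
  | nil _ => rfl
  | cons q l ih => simp [ih]

end LPath

/-! ### Normal virtual bicategories -/

/-- A virtual bicategory: a virtual double category all of whose tight-cells are identities.

`Loose a b` is the class of loose-cells *from `b` to `a`* (codomain first, as in pasting diagrams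
written from right to left), so that a chain `p₁, …, pₙ` of loose-cells
`a₀ ⇸ a₁ ⇸ ⋯ ⇸ aₙ`, each arrow pointing to the left, is an element of `LPath Loose a₀ aₙ`, and
`Cell s q` is the class of 2-cells `s ⇒ q`.

Composition is presented by substitution of one 2-cell `φ : s ⇒ q` into one entry of the source of
another 2-cell `θ : l, q, r ⇒ t`, with result `l, s, r ⇒ t`; the composite `(φ₁, …, φₙ) ; θ` is
obtained by substituting the `φᵢ` one after the other, in an order that does not matter by
`comp_comm`. The sources are only required to be *equal* to `l, q, r` and `l, s, r`, which keeps
the laws free of casts along associativity of concatenation. -/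
structure VirtualBicategory where
  Obj : Type w
  Loose : Obj → Obj → Type v
  Cell : {a b : Obj} → LPath Loose a b → Loose a b → Type t
  /-- The identity 2-cell `q ⇒ q`. -/
  id : {a b : Obj} → (q : Loose a b) → Cell (LPath.one q) q
  /-- Substitution of `φ : s ⇒ q` in `θ : l, q, r ⇒ t`. -/
  comp : {a b c d : Obj} → (l : LPath Loose a b) → (r : LPath Loose c d) →
    {s : LPath Loose b c} → {q : Loose b c} → {t : Loose a d} → {x y : LPath Loose a d} →
    x = l +++ q ::: r → y = l +++ s +++ r → Cell s q → Cell x t → Cell y t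
  id_comp : ∀ {a b c d : Obj} (l : LPath Loose a b) (r : LPath Loose c d) {q : Loose b c}
    {t : Loose a d} {x : LPath Loose a d} (h : x = l +++ q ::: r)
    (h' : x = l +++ LPath.one q +++ r) (θ : Cell x t), comp l r h h' (id q) θ = θ
  comp_id : ∀ {a b : Obj} {s : LPath Loose a b} {q : Loose a b}
    (h : LPath.one q = LPath.nil a +++ q ::: LPath.nil b)
    (h' : s = LPath.nil a +++ s +++ LPath.nil b) (φ : Cell s q),
    comp (LPath.nil a) (LPath.nil b) h h' φ (id q) = φ
  /-- Sequential associativity: `φ` is substituted in `ψ`, and `ψ` in `θ`. -/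
  comp_assoc : ∀ {a b c d e f : Obj} (l : LPath Loose a b) (r : LPath Loose e f)
    (l' : LPath Loose b c) (r' : LPath Loose d e) {s : LPath Loose c d} {q : Loose c d}
    {k : Loose b e} {t : Loose a f} {m m' : LPath Loose b e} {x y z : LPath Loose a f}
    (h₁ : m = l' +++ q ::: r') (h₂ : m' = l' +++ s +++ r')
    (h₃ : x = l +++ k ::: r) (h₄ : y = l +++ m +++ r)
    (h₅ : y = (l +++ l') +++ q ::: (r' +++ r))
    (h₆ : z = l +++ m' +++ r) (h₇ : z = (l +++ l') +++ s +++ (r' +++ r))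
    (φ : Cell s q) (ψ : Cell m k) (θ : Cell x t),
    comp l r h₃ h₆ (comp l' r' h₁ h₂ φ ψ) θ
      = comp (l +++ l') (r' +++ r) h₅ h₇ φ (comp l r h₃ h₄ ψ θ)
  /-- Substitutions in two different entries of `θ : l, q, m, q', r ⇒ t` commute. -/
  comp_comm : ∀ {a b c d e f : Obj} (l : LPath Loose a b) (m : LPath Loose c d)
    (r : LPath Loose e f) {s : LPath Loose b c} {q : Loose b c} {s' : LPath Loose d e}
    {q' : Loose d e} {t : Loose a f} {x y y' z : LPath Loose a f}
    (h₁ : x = l +++ q ::: (m +++ q' ::: r)) (h₂ : y = l +++ s +++ (m +++ q' ::: r))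
    (h₃ : y = (l +++ s +++ m) +++ q' ::: r) (h₄ : z = (l +++ s +++ m) +++ s' +++ r)
    (h₅ : x = (l +++ q ::: m) +++ q' ::: r) (h₆ : y' = (l +++ q ::: m) +++ s' +++ r)
    (h₇ : y' = l +++ q ::: (m +++ s' +++ r)) (h₈ : z = l +++ s +++ (m +++ s' +++ r))
    (φ : Cell s q) (φ' : Cell s' q') (θ : Cell x t),
    comp (l +++ s +++ m) r h₃ h₄ φ' (comp l (m +++ q' ::: r) h₁ h₂ φ θ)
      = comp l (m +++ s' +++ r) h₇ h₈ φ (comp (l +++ q ::: m) r h₅ h₆ φ' θ)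

namespace VirtualBicategory

/-- Chains of loose-cells. -/
abbrev Path (V : VirtualBicategory.{w, v, t}) (a b : V.Obj) := LPath V.Loose a b

/-- A virtual bicategory is normal when every object `a` has a loose-identity: a loose-cell
`a ⇸ a` with an opcartesian nullary 2-cell. -/
class Normal (V : VirtualBicategory.{w, v, t}) where
  idL (a : V.Obj) : V.Loose a a
  eta (a : V.Obj) : V.Cell (LPath.nil a) (idL a)
  existsUnique {a b c : V.Obj} (l : V.Path a b) (r : V.Path b c) {t : V.Loose a c}
    (φ : V.Cell (l +++ r) t) :
    ∃! φ' : V.Cell (l +++ idL b ::: r) t, V.comp l r rfl rfl (eta b) φ' = φ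

/-- A 2-cell whiskered by chains of loose-cells on both sides, as an arrow between chains. -/
inductive Whisk (V : VirtualBicategory.{w, v, t}) {a d : V.Obj} :
    V.Path a d → V.Path a d → Type (max w v t)
  | mk {b c : V.Obj} (l : V.Path a b) {s : V.Path b c} {q : V.Loose b c} (φ : V.Cell s q)
      (r : V.Path c d) : Whisk V (l +++ s +++ r) (l +++ q ::: r)

namespace Whisk

variable {V : VirtualBicategory.{w, v, t}}

/-- Composition of a whiskered 2-cell with a 2-cell. -/
def apply {a d : V.Obj} {s s' : V.Path a d} {k : V.Loose a d} :
    Whisk V s s' → V.Cell s' k → V.Cell s k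
  | mk l φ r, θ => V.comp l r rfl rfl φ θ

/-- Whiskering by a further loose-cell on the left. -/
def cons {a b d : V.Obj} (m : V.Loose a b) {s s' : V.Path b d} :
    Whisk V s s' → Whisk V (m ::: s) (m ::: s')
  | mk l φ r => mk (m ::: l) φ r

end Whisk

end VirtualBicategory

open VirtualBicategory

/-! ### Enriched categories, functors and distributors -/

/-- A `V`-category. The class of objects is presented together with its extents: `Ob a` is the
class of objects of extent `a`. For `x` of extent `a` and `y` of extent `b`, the hom-morphism
`C(x, y)` is a loose-cell `b ⇸ a`. -/
structure VCat (V : VirtualBicategory.{w, v, t}) where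
  Ob : V.Obj → Type u
  Hom : {a b : V.Obj} → Ob a → Ob b → V.Loose a b
  one : {a : V.Obj} → (x : Ob a) → V.Cell (LPath.nil a) (Hom x x)
  mul : {a b c : V.Obj} → (x : Ob a) → (y : Ob b) → (z : Ob c) →
    V.Cell (Hom x y ::: LPath.one (Hom y z)) (Hom x z)
  one_mul : ∀ {a b : V.Obj} (x : Ob a) (y : Ob b),
    V.comp (LPath.nil a) (LPath.one (Hom x y)) rfl rfl (one x) (mul x x y) = V.id (Hom x y)
  mul_one : ∀ {a b : V.Obj} (x : Ob a) (y : Ob b),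
    V.comp (LPath.one (Hom x y)) (LPath.nil b) rfl rfl (one y) (mul x y y) = V.id (Hom x y)
  assoc : ∀ {a b c d : V.Obj} (x : Ob a) (y : Ob b) (z : Ob c) (k : Ob d),
    V.comp (y := Hom x y ::: Hom y z ::: LPath.one (Hom z k))
        (LPath.nil a) (LPath.one (Hom z k)) rfl rfl (mul x y z) (mul x z k)
      = V.comp (LPath.one (Hom x y)) (LPath.nil d) rfl rfl (mul y z k) (mul x y k)

/-- A `V`-functor; it preserves extents. -/
@[ext]
structure VFunctor {V : VirtualBicategory.{w, v, t}} (C D : VCat.{u} V) where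
  obj : {a : V.Obj} → C.Ob a → D.Ob a
  map : {a b : V.Obj} → (x : C.Ob a) → (y : C.Ob b) →
    V.Cell (LPath.one (C.Hom x y)) (D.Hom (obj x) (obj y))
  map_one : ∀ {a : V.Obj} (x : C.Ob a),
    V.comp (LPath.nil a) (LPath.nil a) rfl rfl (C.one x) (map x x) = D.one (obj x)
  map_mul : ∀ {a b c : V.Obj} (x : C.Ob a) (y : C.Ob b) (z : C.Ob c),
    V.comp (y := C.Hom x y ::: LPath.one (C.Hom y z))
        (LPath.nil a) (LPath.nil c) rfl rfl (C.mul x y z) (map x z)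
      = V.comp (LPath.nil a) (LPath.one (C.Hom y z)) rfl rfl (map x y)
          (V.comp (LPath.one (D.Hom (obj x) (obj y))) (LPath.nil c) rfl rfl (map y z)
            (D.mul (obj x) (obj y) (obj z)))

/-- `VDist C D` is the class of `V`-distributors *from `D` to `C`* (codomain first): `p(x, y)`,
for `x` in `C` and `y` in `D`, is contravariant in `x` and covariant in `y`. -/
@[ext]
structure VDist {V : VirtualBicategory.{w, v, t}} (C D : VCat.{u} V) where
  Hom : {a b : V.Obj} → C.Ob a → D.Ob b → V.Loose a b
  actL : {a a' b : V.Obj} → (x : C.Ob a) → (x' : C.Ob a') → (y : D.Ob b) →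
    V.Cell (C.Hom x x' ::: LPath.one (Hom x' y)) (Hom x y)
  actR : {a b b' : V.Obj} → (x : C.Ob a) → (y : D.Ob b) → (y' : D.Ob b') →
    V.Cell (Hom x y ::: LPath.one (D.Hom y y')) (Hom x y')
  one_actL : ∀ {a b : V.Obj} (x : C.Ob a) (y : D.Ob b),
    V.comp (LPath.nil a) (LPath.one (Hom x y)) rfl rfl (C.one x) (actL x x y) = V.id (Hom x y)
  mul_actL : ∀ {a a' a'' b : V.Obj} (x : C.Ob a) (x' : C.Ob a') (x'' : C.Ob a'') (y : D.Ob b),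
    V.comp (y := C.Hom x x' ::: C.Hom x' x'' ::: LPath.one (Hom x'' y))
        (LPath.nil a) (LPath.one (Hom x'' y)) rfl rfl (C.mul x x' x'') (actL x x'' y)
      = V.comp (LPath.one (C.Hom x x')) (LPath.nil b) rfl rfl (actL x' x'' y) (actL x x' y)
  actR_one : ∀ {a b : V.Obj} (x : C.Ob a) (y : D.Ob b),
    V.comp (LPath.one (Hom x y)) (LPath.nil b) rfl rfl (D.one y) (actR x y y) = V.id (Hom x y)
  actR_mul : ∀ {a b b' b'' : V.Obj} (x : C.Ob a) (y : D.Ob b) (y' : D.Ob b') (y'' : D.Ob b''),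
    V.comp (y := Hom x y ::: D.Hom y y' ::: LPath.one (D.Hom y' y''))
        (LPath.nil a) (LPath.one (D.Hom y' y'')) rfl rfl (actR x y y') (actR x y' y'')
      = V.comp (LPath.one (Hom x y)) (LPath.nil b'') rfl rfl (D.mul y y' y'') (actR x y y'')
  actL_actR : ∀ {a a' b b' : V.Obj} (x : C.Ob a) (x' : C.Ob a') (y : D.Ob b) (y' : D.Ob b'),
    V.comp (y := C.Hom x x' ::: Hom x' y ::: LPath.one (D.Hom y y'))
        (LPath.nil a) (LPath.one (D.Hom y y')) rfl rfl (actL x x' y) (actR x y y')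
      = V.comp (LPath.one (C.Hom x x')) (LPath.nil b') rfl rfl (actR x' y y') (actL x x' y')

/-- The loose-identity `C(1, 1)`, that is, the identity `V`-distributor on `C`. -/
def VCat.idDist {V : VirtualBicategory.{w, v, t}} (C : VCat.{u} V) : VDist C C where
  Hom x y := C.Hom x y
  actL x x' y := C.mul x x' y
  actR x y y' := C.mul x y y'
  one_actL := C.one_mul
  mul_actL := C.assoc
  actR_one := C.mul_one
  actR_mul := C.assoc
  actL_actR := C.assoc

/-- The restriction `p(1, f)` of a `V`-distributor `p` along a `V`-functor `f`, given by
`p(1, f)(x, y) = p(x, f y)`. -/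
def VDist.restrict {V : VirtualBicategory.{w, v, t}} {C D E : VCat.{u} V} (p : VDist C D)
    (f : VFunctor E D) : VDist C E where
  Hom x y := p.Hom x (f.obj y)
  actL x x' y := p.actL x x' (f.obj y)
  actR {_ _ b'} x y y' := V.comp (LPath.one (p.Hom x (f.obj y))) (LPath.nil b') rfl rfl
    (f.map y y') (p.actR x (f.obj y) (f.obj y'))
  one_actL x y := p.one_actL x (f.obj y)
  mul_actL x x' x'' y := p.mul_actL x x' x'' (f.obj y)
  actR_one {a b} x y := by
    have e := V.comp_assoc (LPath.one (p.Hom x (f.obj y))) (LPath.nil b) (LPath.nil b)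
      (LPath.nil b) (y := p.Hom x (f.obj y) ::: LPath.one (E.Hom y y))
      (z := LPath.one (p.Hom x (f.obj y)))
      rfl rfl rfl rfl rfl rfl rfl (E.one y) (f.map y y) (p.actR x (f.obj y) (f.obj y))
    refine e.symm.trans (Eq.trans ?_ (p.actR_one x (f.obj y)))
    exact congrArg (fun θ => V.comp (LPath.one (p.Hom x (f.obj y))) (LPath.nil b) rfl rfl θ
      (p.actR x (f.obj y) (f.obj y))) (f.map_one y)
  actR_mul {a b b' b''} x y y' y'' := by
    have e₁ := V.comp_assoc (LPath.one (p.Hom x (f.obj y))) (LPath.nil b'') (LPath.nil b)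
      (LPath.nil b'') (y := p.Hom x (f.obj y) ::: LPath.one (E.Hom y y''))
      (z := p.Hom x (f.obj y) ::: E.Hom y y' ::: LPath.one (E.Hom y' y''))
      rfl rfl rfl rfl rfl rfl rfl (E.mul y y' y'') (f.map y y'')
      (p.actR x (f.obj y) (f.obj y''))
    have e₂ := V.comp_assoc (LPath.one (p.Hom x (f.obj y))) (LPath.nil b'') (LPath.nil b)
      (LPath.one (E.Hom y' y''))
      (y := p.Hom x (f.obj y) ::: D.Hom (f.obj y) (f.obj y') ::: LPath.one (E.Hom y' y''))
      (z := p.Hom x (f.obj y) ::: E.Hom y y' ::: LPath.one (E.Hom y' y''))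
      rfl rfl rfl rfl rfl rfl rfl (f.map y y')
      (V.comp (LPath.one (D.Hom (f.obj y) (f.obj y'))) (LPath.nil b'') rfl rfl (f.map y' y'')
        (D.mul (f.obj y) (f.obj y') (f.obj y'')))
      (p.actR x (f.obj y) (f.obj y''))
    have e₃ := V.comp_assoc (LPath.one (p.Hom x (f.obj y))) (LPath.nil b'')
      (LPath.one (D.Hom (f.obj y) (f.obj y'))) (LPath.nil b'')
      (y := p.Hom x (f.obj y) ::: D.Hom (f.obj y) (f.obj y') :::
        LPath.one (D.Hom (f.obj y') (f.obj y'')))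
      (z := p.Hom x (f.obj y) ::: D.Hom (f.obj y) (f.obj y') ::: LPath.one (E.Hom y' y''))
      rfl rfl rfl rfl rfl rfl rfl (f.map y' y'')
      (D.mul (f.obj y) (f.obj y') (f.obj y'')) (p.actR x (f.obj y) (f.obj y''))
    have e₄ := V.comp_assoc (LPath.nil a) (LPath.one (E.Hom y' y''))
      (LPath.one (p.Hom x (f.obj y))) (LPath.nil b')
      (x := p.Hom x (f.obj y') ::: LPath.one (E.Hom y' y''))
      (y := p.Hom x (f.obj y) ::: D.Hom (f.obj y) (f.obj y') ::: LPath.one (E.Hom y' y''))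
      (z := p.Hom x (f.obj y) ::: E.Hom y y' ::: LPath.one (E.Hom y' y''))
      rfl rfl rfl rfl rfl rfl rfl (f.map y y') (p.actR x (f.obj y) (f.obj y'))
      (V.comp (LPath.one (p.Hom x (f.obj y'))) (LPath.nil b'') rfl rfl (f.map y' y'')
        (p.actR x (f.obj y') (f.obj y'')))
    have e₅ := V.comp_comm (LPath.nil a) (LPath.nil b') (LPath.nil b'')
      (x := p.Hom x (f.obj y') ::: LPath.one (D.Hom (f.obj y') (f.obj y'')))
      (y := p.Hom x (f.obj y) ::: D.Hom (f.obj y) (f.obj y') :::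
        LPath.one (D.Hom (f.obj y') (f.obj y'')))
      (y' := p.Hom x (f.obj y') ::: LPath.one (E.Hom y' y''))
      (z := p.Hom x (f.obj y) ::: D.Hom (f.obj y) (f.obj y') ::: LPath.one (E.Hom y' y''))
      rfl rfl rfl rfl rfl rfl rfl rfl (p.actR x (f.obj y) (f.obj y')) (f.map y' y'')
      (p.actR x (f.obj y') (f.obj y''))
    have e₆ := congrArg (fun θ => V.comp (LPath.one (p.Hom x (f.obj y))) (LPath.nil b'')
      (y := p.Hom x (f.obj y) ::: E.Hom y y' ::: LPath.one (E.Hom y' y''))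
      rfl rfl θ (p.actR x (f.obj y) (f.obj y''))) (f.map_mul y y' y'')
    refine Eq.trans ?_ (e₂.symm.trans (e₆.symm.trans e₁))
    refine e₄.trans (congrArg _ (e₅.symm.trans (Eq.trans ?_ e₃.symm)))
    exact congrArg _ (p.actR_mul x (f.obj y) (f.obj y') (f.obj y''))
  actL_actR {a a' b b'} x x' y y' := by
    have e₁ := V.comp_comm (LPath.nil a) (LPath.nil b) (LPath.nil b')
      (x := p.Hom x (f.obj y) ::: LPath.one (D.Hom (f.obj y) (f.obj y')))
      (y := C.Hom x x' ::: p.Hom x' (f.obj y) ::: LPath.one (D.Hom (f.obj y) (f.obj y')))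
      (y' := p.Hom x (f.obj y) ::: LPath.one (E.Hom y y'))
      (z := C.Hom x x' ::: p.Hom x' (f.obj y) ::: LPath.one (E.Hom y y'))
      rfl rfl rfl rfl rfl rfl rfl rfl (p.actL x x' (f.obj y)) (f.map y y')
      (p.actR x (f.obj y) (f.obj y'))
    have e₂ := V.comp_assoc (LPath.one (C.Hom x x')) (LPath.nil b')
      (LPath.one (p.Hom x' (f.obj y))) (LPath.nil b')
      (y := C.Hom x x' ::: p.Hom x' (f.obj y) ::: LPath.one (D.Hom (f.obj y) (f.obj y')))
      (z := C.Hom x x' ::: p.Hom x' (f.obj y) ::: LPath.one (E.Hom y y'))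
      rfl rfl rfl rfl rfl rfl rfl (f.map y y') (p.actR x' (f.obj y) (f.obj y'))
      (p.actL x x' (f.obj y'))
    exact e₁.symm.trans ((congrArg _ (p.actL_actR x x' (f.obj y) (f.obj y'))).trans e₂.symm)

/-! ### Natural transformations -/

/-- Chains of `V`-distributors `C₀ ⇸ ⋯ ⇸ Cₙ` (each arrow pointing to the left). -/
abbrev VChain {V : VirtualBicategory.{w, v, t}} (C D : VCat.{u} V) :=
  LPath (VDist (V := V)) C D

/-- For a chain `p₁, …, pₙ` of `V`-distributors, the families of objects `x₀, …, xₙ` of the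
`V`-categories of the chain, with prescribed first entry `x₀` and last entry `xₙ`. -/
inductive Pts {V : VirtualBicategory.{w, v, t}} : {C D : VCat.{u} V} → VChain C D →
    {a b : V.Obj} → C.Ob a → D.Ob b → Type (max (u + 1) w v t)
  | nil {C : VCat.{u} V} {a : V.Obj} (x : C.Ob a) : Pts (LPath.nil C) x x
  | cons {C D E : VCat.{u} V} {p : VDist C D} {r : VChain D E} {a b c : V.Obj} (x : C.Ob a)
      {y : D.Ob b} {z : E.Ob c} (ys : Pts r y z) : Pts (p ::: r) x z

namespace Pts

variable {V : VirtualBicategory.{w, v, t}}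

/-- The chain `p₁(x₀, x₁), …, pₙ(xₙ₋₁, xₙ)` of loose-cells. -/
def path : {C D : VCat.{u} V} → {r : VChain C D} → {a b : V.Obj} → {x : C.Ob a} →
    {y : D.Ob b} → Pts r x y → V.Path a b
  | _, _, _, a, _, _, _, nil _ => LPath.nil a
  | _, _, _, _, _, _, _, cons (p := p) (y := y) x ys => p.Hom x y ::: ys.path

end Pts

/-- For a chain `p₁, …, pₙ` of `V`-distributors from `Cₙ` to `C₀`, the families of objects as in
`Pts`, except that at one position `0 ≤ i ≤ n` *two* objects `xᵢ, xᵢ'` of `Cᵢ` are chosen: `xᵢ` is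
used on the left and `xᵢ'` on the right. -/
inductive Ins {V : VirtualBicategory.{w, v, t}} : {C D : VCat.{u} V} → VChain C D →
    {a b : V.Obj} → C.Ob a → D.Ob b → Type (max (u + 1) w v t)
  | here {C D : VCat.{u} V} {r : VChain C D} {a a' b : V.Obj} (x : C.Ob a) {x' : C.Ob a'}
      {y : D.Ob b} (xs : Pts r x' y) : Ins r x y
  | there {C D E : VCat.{u} V} {p : VDist C D} {r : VChain D E} {a b c : V.Obj} (x : C.Ob a)
      {y : D.Ob b} {z : E.Ob c} (i : Ins r y z) : Ins (p ::: r) x z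

/-- The chain `p₁(x₀, x₁), …, pᵢ(xᵢ₋₁, xᵢ), Cᵢ(xᵢ, xᵢ'), pᵢ₊₁(xᵢ', xᵢ₊₁), …, pₙ(xₙ₋₁, xₙ)`. -/
def Ins.path {V : VirtualBicategory.{w, v, t}} : {C D : VCat.{u} V} → {r : VChain C D} →
    {a b : V.Obj} → {x : C.Ob a} → {y : D.Ob b} → Ins r x y → V.Path a b
  | C, _, _, _, _, _, _, here (x' := x') x xs => C.Hom x x' ::: xs.path
  | _, _, _, _, _, _, _, there (p := p) (y := y) x i => p.Hom x y ::: i.path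

/-- The ways in which a family of 2-cells `p₁(x₀, x₁), …, pₙ(xₙ₋₁, xₙ) ⇒ q(x₀, xₙ)` determines a
2-cell `s ⇒ q(x, y)` by means of one action: `s` is acted on first (`inner`), or the left action
(`left`) or the right action (`right`) of `q` is applied to a member of the family. -/
inductive Step {V : VirtualBicategory.{w, v, t}} {C D : VCat.{u} V} (r : VChain C D)
    {a b : V.Obj} (x : C.Ob a) (y : D.Ob b) : V.Path a b → Type (max (u + 1) w v t)
  | inner {s : V.Path a b} (xs : Pts r x y) (f : Whisk V s xs.path) : Step r x y s
  | left {a' : V.Obj} {x' : C.Ob a'} (xs : Pts r x' y) : Step r x y (C.Hom x x' ::: xs.path)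
  | right {b' : V.Obj} {y' : D.Ob b'} (xs : Pts r x y') :
      Step r x y (xs.path +++ LPath.one (D.Hom y' y))

namespace Step

variable {V : VirtualBicategory.{w, v, t}}

/-- The 2-cell `s ⇒ q(x, y)` determined by a family of 2-cells. -/
def eval {C D : VCat.{u} V} {r : VChain C D} {q : VDist C D}
    (app : {a b : V.Obj} → {x : C.Ob a} → {y : D.Ob b} → (xs : Pts r x y) →
      V.Cell xs.path (q.Hom x y)) {a b : V.Obj} {x : C.Ob a} {y : D.Ob b} {s : V.Path a b} :
    Step r x y s → V.Cell s (q.Hom x y)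
  | inner xs f => f.apply (app xs)
  | left (x' := x') xs => V.comp (LPath.one (C.Hom x x')) (LPath.nil b) rfl (by simp)
      (app xs) (q.actL x x' y)
  | right (y' := y') xs => V.comp (LPath.nil a) (LPath.one (D.Hom y' y)) rfl rfl
      (app xs) (q.actR x y' y)

/-- Adding a `V`-distributor `p` on the left of the chain; an action on the left of the shorter
chain is replaced by the right action on `p`. -/
def cons {C D E : VCat.{u} V} {p : VDist C D} {r : VChain D E} {a b c : V.Obj} (x : C.Ob a)
    {y : D.Ob b} {z : E.Ob c} {s : V.Path b c} : Step r y z s → Step (p ::: r) x z (p.Hom x y ::: s)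
  | inner ys f => inner (Pts.cons x ys) (f.cons (p.Hom x y))
  | left (x' := y') ys => inner (Pts.cons x ys) (Whisk.mk (LPath.nil a) (p.actR x y y') ys.path)
  | right ys => right (Pts.cons x ys)

end Step

namespace Ins

variable {V : VirtualBicategory.{w, v, t}}

/-- Let the hom-morphism `Cᵢ(xᵢ, xᵢ')` act to its left: on `pᵢ` if `0 < i`, on `q` if `i = 0`. -/
def toLeft : {C D : VCat.{u} V} → {r : VChain C D} → {a b : V.Obj} → {x : C.Ob a} →
    {y : D.Ob b} → (i : Ins r x y) → Step r x y i.path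
  | _, _, _, _, _, _, _, here _ xs => Step.left xs
  | _, _, _, _, _, _, _, there x i => i.toLeft.cons x

/-- Let the hom-morphism `Cᵢ(xᵢ, xᵢ')` act to its right: on `pᵢ₊₁` if `i < n`, on `q` if `i = n`. -/
def toRight : {C D : VCat.{u} V} → {r : VChain C D} → {a b : V.Obj} → {x : C.Ob a} →
    {y : D.Ob b} → (i : Ins r x y) → Step r x y i.path
  | _, _, _, _, _, _, _, here x (Pts.nil _) => Step.right (Pts.nil x)
  | _, _, _, a, _, _, _, here x (Pts.cons (p := p) (y := y) x' ys) =>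
      Step.inner (Pts.cons x ys) (Whisk.mk (LPath.nil a) (p.actL x x' y) ys.path)
  | _, _, _, _, _, _, _, there x i => i.toRight.cons x

end Ins

/-- A (globular) `V`-natural transformation `p₁, …, pₙ ⇒ q` of `V`-distributors: a family of
2-cells `p₁(x₀, x₁), …, pₙ(xₙ₋₁, xₙ) ⇒ q(x₀, xₙ)` such that, for each `0 ≤ i ≤ n`, the two
2-cells with source `p₁(x₀, x₁), …, pᵢ(xᵢ₋₁, xᵢ), Cᵢ(xᵢ, xᵢ'), pᵢ₊₁(xᵢ', xᵢ₊₁), …` and target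
`q(x₀, xₙ)`, in which `Cᵢ(xᵢ, xᵢ')` acts to its left and to its right, are equal. -/
@[ext]
structure VTrans {V : VirtualBicategory.{w, v, t}} {C D : VCat.{u} V} (r : VChain C D)
    (q : VDist C D) where
  app : {a b : V.Obj} → {x : C.Ob a} → {y : D.Ob b} → (xs : Pts r x y) →
    V.Cell xs.path (q.Hom x y)
  natural : ∀ {a b : V.Obj} {x : C.Ob a} {y : D.Ob b} (i : Ins r x y),
    i.toLeft.eval app = i.toRight.eval app

/-! ### Right lifts, density, repletion -/

section

variable {V : VirtualBicategory.{w, v, t}}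

/-- A `V`-natural transformation `ϖ : p, l ⇒ q` exhibits `l` as the right lift `q ◂ p` when every
`φ : p, r₁, …, rₙ ⇒ q` (`n ≥ 0`) factors uniquely as `ϖ` after a `ψ : r₁, …, rₙ ⇒ l`. -/
def IsRightLift {A B C : VCat.{u} V} {p : VDist A B} {q : VDist A C} {l : VDist B C}
    (ϖ : VTrans (p ::: LPath.one l) q) : Prop :=
  ∀ (r : VChain B C) (φ : VTrans (p ::: r) q), ∃! ψ : VTrans r l,
    ∀ {a b c : V.Obj} (x : A.Ob a) {y : B.Ob b} {z : C.Ob c} (ys : Pts r y z),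
      φ.app (Pts.cons x ys) = V.comp (LPath.one (p.Hom x y)) (LPath.nil c) rfl
        (by simp [Pts.path]) (ψ.app ys) (ϖ.app (Pts.cons x (Pts.cons y (Pts.nil z))))

/-- The right lift `q ◂ p` exists. -/
def HasRightLift {A B C : VCat.{u} V} (q : VDist A C) (p : VDist A B) : Prop :=
  ∃ (l : VDist B C) (ϖ : VTrans (p ::: LPath.one l) q), IsRightLift ϖ

/-- The right action of `B` on `p`, as a `V`-natural transformation `p, B(1, 1) ⇒ p`: it
corresponds to the identity `p ⇒ p` under the universal property of the loose-identity. -/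
def VDist.actTrans {A B : VCat.{u} V} (p : VDist A B) :
    VTrans (p ::: LPath.one B.idDist) p where
  app := fun {_ _ _ _} xs => match xs with
    | Pts.cons x (Pts.cons y (Pts.nil z)) => p.actR x y z
  natural := fun {_ _ _ _} i => by
    match i with
    | Ins.here x (Pts.cons x' (Pts.cons y (Pts.nil z))) => exact (p.actL_actR x x' y z).symm
    | Ins.there x (Ins.here y (Pts.cons y' (Pts.nil z))) => exact p.actR_mul x y y' z
    | Ins.there x (Ins.there y (Ins.here z (Pts.nil z'))) => exact (p.actR_mul x y z z').symm

/-- A `V`-distributor `p` from `B` to `A` is dense when the identity `p ⇒ p` exhibits `B(1, 1)` as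
the right lift `p ◂ p`. -/
def VDist.Dense {A B : VCat.{u} V} (p : VDist A B) : Prop :=
  IsRightLift p.actTrans

/-- `p` and `q` are isomorphic by (globular) `V`-natural transformations. -/
def VDist.Iso {A B : VCat.{u} V} (p q : VDist A B) : Prop :=
  ∃ (f : VTrans (LPath.one p) q) (g : VTrans (LPath.one q) p),
    ∀ {a b : V.Obj} (x : A.Ob a) (y : B.Ob b),
      V.comp (LPath.nil a) (LPath.nil b) rfl rfl (f.app (Pts.cons x (Pts.nil y)))
        (g.app (Pts.cons x (Pts.nil y))) = V.id (p.Hom x y) ∧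
      V.comp (LPath.nil a) (LPath.nil b) rfl rfl (g.app (Pts.cons x (Pts.nil y)))
        (f.app (Pts.cons x (Pts.nil y))) = V.id (q.Hom x y)

end

/-! ### One-object categories and presheaves -/

/-- The class of objects of extent `a` of the `V`-category `⋆ₑ`: it has a single object, of
extent `e`. -/
inductive StarOb {O : Type w} (e : O) : O → Type u
  | pt : StarOb e e

section

variable {V : VirtualBicategory.{w, v, t}} [V.Normal]

/-- The uniqueness part of the universal property of a loose-identity. -/
theorem VirtualBicategory.Normal.ext {a b c : V.Obj} (l : V.Path a b) (r : V.Path b c)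
    {k : V.Loose a c} {φ ψ : V.Cell (l +++ Normal.idL b ::: r) k}
    (h : V.comp (y := l +++ r) l r rfl rfl (Normal.eta b) φ
      = V.comp (y := l +++ r) l r rfl rfl (Normal.eta b) ψ) : φ = ψ :=
  (Normal.existsUnique l r _).unique h rfl

/-- The composition `id, id ⇒ id` of a loose-identity: the unique 2-cell whose composite with
the nullary 2-cell in the first entry is the identity. -/
noncomputable def VirtualBicategory.Normal.mulId (e : V.Obj) :
    V.Cell (Normal.idL e ::: LPath.one (Normal.idL e)) (Normal.idL (V := V) e) :=
  (Normal.existsUnique (LPath.nil e) (LPath.one (Normal.idL e)) (V.id (Normal.idL e))).choose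

theorem VirtualBicategory.Normal.eta_mulId (e : V.Obj) :
    V.comp (LPath.nil e) (LPath.one (Normal.idL e)) rfl rfl (Normal.eta e) (Normal.mulId e)
      = V.id (Normal.idL e) :=
  (Normal.existsUnique (LPath.nil e) (LPath.one (Normal.idL e))
    (V.id (Normal.idL e))).choose_spec.1

/-- For `a` in `A` of extent `e`, the unique 2-cell `id ⇒ A(a, a)` out of the loose-identity on `e`
that corresponds to the identity of `a`. -/
noncomputable def VCat.unitCell (A : VCat.{u} V) {e : V.Obj} (a : A.Ob e) :
    V.Cell (LPath.one (Normal.idL e)) (A.Hom a a) :=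
  (Normal.existsUnique (LPath.nil e) (LPath.nil e) (A.one a)).choose

theorem VCat.eta_unitCell (A : VCat.{u} V) {e : V.Obj} (a : A.Ob e) :
    V.comp (LPath.nil e) (LPath.nil e) rfl rfl (Normal.eta e) (A.unitCell a) = A.one a :=
  (Normal.existsUnique (LPath.nil e) (LPath.nil e) (A.one a)).choose_spec.1

theorem VirtualBicategory.Normal.mulId_eta (e : V.Obj) :
    V.comp (LPath.one (Normal.idL e)) (LPath.nil e) rfl rfl (Normal.eta e) (Normal.mulId e)
      = V.id (Normal.idL e) := by
  apply Normal.ext (LPath.nil e) (LPath.nil e)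
  have e₁ := V.comp_comm (LPath.nil e) (LPath.nil e) (LPath.nil e)
    (x := Normal.idL e ::: LPath.one (Normal.idL e)) (y := LPath.one (Normal.idL e))
    (y' := LPath.one (Normal.idL e)) (z := LPath.nil e)
    rfl rfl rfl rfl rfl rfl rfl rfl (Normal.eta e) (Normal.eta e) (Normal.mulId e)
  refine e₁.symm.trans ?_
  exact congrArg (V.comp (LPath.nil e) (LPath.nil e) rfl rfl (Normal.eta e)) (Normal.eta_mulId e)

theorem VirtualBicategory.Normal.mulId_assoc (e : V.Obj) :
    V.comp (y := Normal.idL e ::: Normal.idL e ::: LPath.one (Normal.idL e))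
        (LPath.nil e) (LPath.one (Normal.idL e)) rfl rfl (Normal.mulId e) (Normal.mulId e)
      = V.comp (LPath.one (Normal.idL e)) (LPath.nil e) rfl rfl (Normal.mulId e)
          (Normal.mulId e) := by
  apply Normal.ext (LPath.nil e) (Normal.idL e ::: LPath.one (Normal.idL e))
  have e₁ := V.comp_assoc (LPath.nil e) (LPath.one (Normal.idL e)) (LPath.nil e)
    (LPath.one (Normal.idL e)) (x := Normal.idL e ::: LPath.one (Normal.idL e))
    (y := Normal.idL e ::: Normal.idL e ::: LPath.one (Normal.idL e))
    (z := Normal.idL e ::: LPath.one (Normal.idL e))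
    rfl rfl rfl rfl rfl rfl rfl (Normal.eta e) (Normal.mulId e) (Normal.mulId e)
  have e₂ := V.comp_comm (LPath.nil e) (LPath.nil e) (LPath.nil e)
    (x := Normal.idL e ::: LPath.one (Normal.idL e)) (y := LPath.one (Normal.idL e))
    (y' := Normal.idL e ::: Normal.idL e ::: LPath.one (Normal.idL e))
    (z := Normal.idL e ::: LPath.one (Normal.idL e))
    rfl rfl rfl rfl rfl rfl rfl rfl (Normal.eta e) (Normal.mulId e) (Normal.mulId e)
  have e₃ := congrArg (fun θ => V.comp (LPath.nil e) (LPath.one (Normal.idL e))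
    (y := Normal.idL e ::: LPath.one (Normal.idL e)) rfl rfl θ (Normal.mulId e))
    (Normal.eta_mulId e)
  have e₄ := congrArg (fun θ => V.comp (LPath.nil e) (LPath.nil e)
    (y := Normal.idL e ::: LPath.one (Normal.idL e)) rfl rfl (Normal.mulId e) θ)
    (Normal.eta_mulId e)
  refine e₁.symm.trans (e₃.trans (Eq.trans ?_ (e₄.symm.trans e₂)))
  exact (V.id_comp (LPath.nil e) (LPath.one (Normal.idL e)) rfl rfl (Normal.mulId e)).trans
    (V.comp_id rfl rfl (Normal.mulId e)).symm

theorem VCat.mulId_unitCell (A : VCat.{u} V) {e : V.Obj} (a : A.Ob e) :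
    V.comp (y := Normal.idL e ::: LPath.one (Normal.idL e))
        (LPath.nil e) (LPath.nil e) rfl rfl (Normal.mulId e) (A.unitCell a)
      = V.comp (LPath.nil e) (LPath.one (Normal.idL e)) rfl rfl (A.unitCell a)
          (V.comp (LPath.one (A.Hom a a)) (LPath.nil e) rfl rfl (A.unitCell a)
            (A.mul a a a)) := by
  apply Normal.ext (LPath.nil e) (LPath.one (Normal.idL e))
  have e₁ := V.comp_assoc (LPath.nil e) (LPath.nil e) (LPath.nil e)
    (LPath.one (Normal.idL e)) (x := LPath.one (Normal.idL e))
    (y := Normal.idL e ::: LPath.one (Normal.idL e)) (z := LPath.one (Normal.idL e))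
    rfl rfl rfl rfl rfl rfl rfl (Normal.eta e) (Normal.mulId e) (A.unitCell a)
  have e₂ := congrArg (fun θ => V.comp (LPath.nil e) (LPath.nil e)
    (y := LPath.one (Normal.idL e)) rfl rfl θ (A.unitCell a)) (Normal.eta_mulId e)
  have e₃ := V.comp_assoc (LPath.nil e) (LPath.one (Normal.idL e)) (LPath.nil e) (LPath.nil e)
    (x := A.Hom a a ::: LPath.one (Normal.idL e))
    (y := Normal.idL e ::: LPath.one (Normal.idL e)) (z := LPath.one (Normal.idL e))
    rfl rfl rfl rfl rfl rfl rfl (Normal.eta e) (A.unitCell a)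
    (V.comp (LPath.one (A.Hom a a)) (LPath.nil e) rfl rfl (A.unitCell a) (A.mul a a a))
  have e₄ := congrArg (fun θ => V.comp (LPath.nil e) (LPath.one (Normal.idL e))
    (y := LPath.one (Normal.idL e)) rfl rfl θ
    (V.comp (LPath.one (A.Hom a a)) (LPath.nil e) rfl rfl (A.unitCell a) (A.mul a a a)))
    (A.eta_unitCell a)
  have e₅ := V.comp_comm (LPath.nil e) (LPath.nil e) (LPath.nil e)
    (x := A.Hom a a ::: LPath.one (A.Hom a a)) (y := LPath.one (A.Hom a a))
    (y' := A.Hom a a ::: LPath.one (Normal.idL e)) (z := LPath.one (Normal.idL e))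
    rfl rfl rfl rfl rfl rfl rfl rfl (A.one a) (A.unitCell a) (A.mul a a a)
  have e₆ := congrArg (fun θ => V.comp (LPath.nil e) (LPath.nil e)
    (y := LPath.one (Normal.idL e)) rfl rfl (A.unitCell a) θ) (A.one_mul a a)
  refine e₁.symm.trans (e₂.trans (Eq.trans ?_ (e₆.symm.trans (e₅.trans (e₄.symm.trans e₃)))))
  exact (V.id_comp (LPath.nil e) (LPath.nil e) rfl rfl (A.unitCell a)).trans
    (V.comp_id rfl rfl (A.unitCell a)).symm

/-- The `V`-category `⋆ₑ` with a single object, of extent `e`, and hom-morphism the loose-identity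
on `e`. -/
noncomputable def VCat.star (V : VirtualBicategory.{w, v, t}) [V.Normal] (e : V.Obj) :
    VCat.{u} V where
  Ob := StarOb e
  Hom x y := match x, y with
    | StarOb.pt, StarOb.pt => Normal.idL e
  one x := match x with
    | StarOb.pt => Normal.eta e
  mul x y z := match x, y, z with
    | StarOb.pt, StarOb.pt, StarOb.pt => Normal.mulId e
  one_mul x y := match x, y with
    | StarOb.pt, StarOb.pt => Normal.eta_mulId e
  mul_one x y := match x, y with
    | StarOb.pt, StarOb.pt => Normal.mulId_eta e
  assoc x y z k := match x, y, z, k with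
    | StarOb.pt, StarOb.pt, StarOb.pt, StarOb.pt => Normal.mulId_assoc e

/-- The `V`-functor `⋆ₑ → A` that chooses an object `a` of extent `e`. -/
noncomputable def VCat.point (A : VCat.{u} V) {e : V.Obj} (a : A.Ob e) :
    VFunctor (VCat.star V e) A where
  obj x := match x with
    | StarOb.pt => a
  map x y := match x, y with
    | StarOb.pt, StarOb.pt => A.unitCell a
  map_one x := match x with
    | StarOb.pt => A.eta_unitCell a
  map_mul x y z := match x, y, z with
    | StarOb.pt, StarOb.pt, StarOb.pt => A.mulId_unitCell a

/-- A `V`-presheaf on `A` of extent `e` is a `V`-distributor `⋆ₑ ⇸ A`. -/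
abbrev Presheaf (A : VCat.{u} V) (e : V.Obj) := VDist A (VCat.star.{u} V e)

/-- The `V`-presheaf `p(1, b)`, for a `V`-distributor `p : B ⇸ A` and an object `b` of `B`. -/
noncomputable def VDist.presheafAt {A B : VCat.{u} V} (p : VDist A B) {e : V.Obj} (b : B.Ob e) :
    Presheaf A e :=
  p.restrict (B.point b)

end

/-! ### Presheaf objects -/

/-- Classes of `V`-distributors. -/
abbrev DistClass (V : VirtualBicategory.{w, v, t}) :=
  ∀ ⦃A B : VCat.{u} V⦄, VDist A B → Prop

namespace DistClass

variable {V : VirtualBicategory.{w, v, t}}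

/-- A class of `V`-distributors is presheaf-induced when it contains a `V`-distributor `p : B ⇸ A`
if and only if it contains the `V`-presheaf `p(1, b)` for every object `b` of `B`. -/
def PresheafInduced [V.Normal] (P : DistClass.{u} V) : Prop :=
  ∀ ⦃A B : VCat.{u} V⦄ (p : VDist A B), P p ↔ ∀ ⦃e : V.Obj⦄ (b : B.Ob e), P (p.presheafAt b)

/-- The repletion of a class: its closure under isomorphism. -/
def repletion (P : DistClass.{u} V) : DistClass.{u} V :=
  fun _ _ p => ∃ q, P q ∧ VDist.Iso p q

/-- `π : Q ⇸ A` exhibits `Q` as a `P`-presheaf `V`-category for `A`. -/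
structure IsPresheafObject (P : DistClass.{u} V) {A Q : VCat.{u} V} (π : VDist A Q) : Prop where
  dense : π.Dense
  existsUnique : ∀ ⦃X : VCat.{u} V⦄ (p : VDist A X), P p → ∃! f : VFunctor X Q, p = π.restrict f
  mem : ∀ ⦃X : VCat.{u} V⦄ (f : VFunctor X Q), P (π.restrict f)

/-- `A` has a `P`-presheaf `V`-category. -/
def HasPresheafObject (P : DistClass.{u} V) (A : VCat.{u} V) : Prop :=
  ∃ (Q : VCat.{u} V) (π : VDist A Q), P.IsPresheafObject π

/-- `A` is `P`-admissible: it has a `P`-presheaf `V`-category, and its identity `V`-distributor is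
in the repletion of `P`. -/
def Admissible (P : DistClass.{u} V) (A : VCat.{u} V) : Prop :=
  P.HasPresheafObject A ∧ P.repletion A.idDist

end DistClass

/-! The theorem rests on the fact that right lifts of distributors are pointwise. Fix `p : B ⇸ A`,
`q : C ⇸ A`, an object `y` of `B` and an object `z` of `C`. For a chain `s` of loose-cells, consider
the families of 2-cells `p(x, y), s ⇒ q(x, z)`, for `x` in `A`, that respect the left actions of `A`
(`IsNatural`). A pointwise lift is a loose-cell `k` with a universal such family (`IsLiftAt`).

If every `l(y, z)` is a pointwise lift, then `l` is a right lift: 2-cells are factored one component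
at a time, and naturality of the factorization is checked after evaluation
(`isRightLift_of_isLiftAt`).

The converse, `IsRightLift.isLiftAt`, is the main work, since a right lift is tested against chains
of distributors and a pointwise lift against bare chains `s` of loose-cells. Normality of `V` turns
each loose-cell of `s` into a distributor between one-object categories, where naturality is
automatic. Framing `s` by `B(1, y)` and `C(z, 1)` turns a natural family into a 2-cell of
distributors; this is factored through the right lift, evaluated at `y` and `z`, and the identities
of `y` and `z` are inserted.

Hence `π : Q ⇸ A` is dense exactly when each `Q(i, j)` is the pointwise lift of `π(1, j)` through
`π(1, i)`. If `Q` is a presheaf category for `A`, all `P`-presheaves are restrictions of `π`, so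
their lifts exist, being hom-morphisms of `Q`. Conversely, given the lifts, let `Q` have the
`P`-presheaves as objects and the lifts as hom-morphisms, and let `π` be evaluation
(`LiftFamily.cat`, `LiftFamily.dist`). By the universal property of the lifts, an action of `X` on
the loose-cells `π(a, f x)` is the same as the structure of a functor `f : X → Q`
(`VFunctor.ofAction`), so `p` in `P` is classified by `x ↦ p(1, x)`. That `P` is presheaf-induced
puts these presheaves in `P`, and puts `π(1, f)` in `P` for every `f`. -/

/-! ### Calculus of substitutions -/

namespace VirtualBicategory

variable {V : VirtualBicategory.{w, v, t}}

/-- Sequential associativity, with the chains of the composite known up to equality only. -/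
theorem comp_comp {a b c d e f : V.Obj} (l : V.Path a b) (r : V.Path e f)
    (l' : V.Path b c) (r' : V.Path d e) {s : V.Path c d} {q : V.Loose c d}
    {k : V.Loose b e} {t : V.Loose a f} {m m' : V.Path b e} {x y z : V.Path a f}
    {L : V.Path a c} {R : V.Path d f} (hL : L = l +++ l') (hR : R = r' +++ r)
    (h₁ : m = l' +++ q ::: r') (h₂ : m' = l' +++ s +++ r')
    (h₃ : x = l +++ k ::: r) (h₄ : y = l +++ m +++ r) (h₅ : y = L +++ q ::: R)
    (h₆ : z = l +++ m' +++ r) (h₇ : z = L +++ s +++ R)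
    (φ : V.Cell s q) (ψ : V.Cell m k) (θ : V.Cell x t) :
    V.comp l r h₃ h₆ (V.comp l' r' h₁ h₂ φ ψ) θ
      = V.comp L R h₅ h₇ φ (V.comp l r h₃ h₄ ψ θ) := by
  subst hL hR
  exact V.comp_assoc l r l' r' h₁ h₂ h₃ h₄ h₅ h₆ h₇ φ ψ θ

/-- The interchange law, with the chains of the composite known up to equality only. -/
theorem comp_swap {a b c d e f : V.Obj} {l : V.Path a b} (m : V.Path c d)
    {r : V.Path e f} {s : V.Path b c} {q : V.Loose b c} {s' : V.Path d e}
    {q' : V.Loose d e} {t : V.Loose a f} {x y y' z : V.Path a f}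
    {L₁ L₂ : V.Path a d} {R₁ R₂ : V.Path c f}
    (hL₁ : L₁ = l +++ q ::: m) (hL₂ : L₂ = l +++ s +++ m)
    (hR₁ : R₁ = m +++ q' ::: r) (hR₂ : R₂ = m +++ s' +++ r)
    (h₁ : x = l +++ q ::: R₁) (h₂ : y = l +++ s +++ R₁)
    (h₃ : y = L₂ +++ q' ::: r) (h₄ : z = L₂ +++ s' +++ r)
    (h₅ : x = L₁ +++ q' ::: r) (h₆ : y' = L₁ +++ s' +++ r)
    (h₇ : y' = l +++ q ::: R₂) (h₈ : z = l +++ s +++ R₂)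
    (φ : V.Cell s q) (φ' : V.Cell s' q') (θ : V.Cell x t) :
    V.comp L₂ r h₃ h₄ φ' (V.comp l R₁ h₁ h₂ φ θ)
      = V.comp l R₂ h₇ h₈ φ (V.comp L₁ r h₅ h₆ φ' θ) := by
  subst hL₁ hL₂ hR₁ hR₂
  exact V.comp_comm l m r h₁ h₂ h₃ h₄ h₅ h₆ h₇ h₈ φ φ' θ

/-- Substitution of `ψ : s ⇒ k` in the second entry of `θ : p, k ⇒ t`. -/
def post {a b c : V.Obj} {p : V.Loose a b} {s : V.Path b c} {k : V.Loose b c} {t : V.Loose a c}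
    (ψ : V.Cell s k) (θ : V.Cell (p ::: LPath.one k) t) : V.Cell (p ::: s) t :=
  V.comp (LPath.one p) (LPath.nil c) rfl (by simp) ψ θ

theorem post_id {a b c : V.Obj} {p : V.Loose a b} {k : V.Loose b c} {t : V.Loose a c}
    (θ : V.Cell (p ::: LPath.one k) t) : post (V.id k) θ = θ :=
  V.id_comp _ _ _ _ θ

/-- Substitution commutes with `post`. -/
theorem post_comp {a b c d e : V.Obj} {p : V.Loose a b} {l : V.Path b c} {r : V.Path d e}
    {s : V.Path c d} {q : V.Loose c d} {k : V.Loose b e} {t : V.Loose a e}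
    {x y : V.Path b e} (h : x = l +++ q ::: r) (h' : y = l +++ s +++ r)
    (h₁ : (p ::: x) = (p ::: l) +++ q ::: r) (h₁' : (p ::: y) = (p ::: l) +++ s +++ r)
    (φ : V.Cell s q) (ψ : V.Cell x k) (θ : V.Cell (p ::: LPath.one k) t) :
    post (V.comp l r h h' φ ψ) θ = V.comp (p ::: l) r h₁ h₁' φ (post ψ θ) :=
  comp_comp _ _ _ _ (by simp) (by simp) _ _ _ _ _ _ _ φ ψ θ

theorem Whisk.post_apply {a b c : V.Obj} {p : V.Loose a b} {s s' : V.Path b c}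
    (f : Whisk V s s') {k : V.Loose b c} {t : V.Loose a c} (ψ : V.Cell s' k)
    (θ : V.Cell (p ::: LPath.one k) t) :
    post (f.apply ψ) θ = (f.cons p).apply (post ψ θ) := by
  cases f with
  | mk l φ r => exact post_comp _ _ _ _ φ ψ θ

/-- Substitution in the first entry commutes with `post`. -/
theorem comp_post {a c d : V.Obj} {p : V.Loose a c} {m : V.Path a c} {s : V.Path c d}
    {k : V.Loose c d} {t : V.Loose a d} {x y : V.Path a d}
    (h : (p ::: s) = LPath.nil a +++ p ::: s) (h' : x = LPath.nil a +++ m +++ s)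
    (h₁ : (p ::: LPath.one k) = LPath.nil a +++ p ::: LPath.one k)
    (h₂ : y = LPath.nil a +++ m +++ LPath.one k)
    (h₃ : y = m +++ k ::: LPath.nil d) (h₄ : x = m +++ s +++ LPath.nil d)
    (φ : V.Cell m p) (ψ : V.Cell s k) (θ : V.Cell (p ::: LPath.one k) t) :
    V.comp (LPath.nil a) s h h' φ (post ψ θ)
      = V.comp m (LPath.nil d) h₃ h₄ ψ (V.comp (LPath.nil a) (LPath.one k) h₁ h₂ φ θ) :=
  (comp_swap (LPath.nil c) (by simp) (by simp) (by simp) (by simp) _ _ _ _ _ _ _ _ φ ψ θ).symm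

/-- Insertion of a unit `η` in `e, s ⇒ e, k ⇒ k`. -/
theorem comp_post_of_unit {a b : V.Obj} {e : V.Loose a a} {k : V.Loose a b} {s : V.Path a b}
    {η : V.Cell (LPath.nil a) e} {θ : V.Cell (e ::: LPath.one k) k}
    (h : V.comp (LPath.nil a) (LPath.one k) rfl rfl η θ = V.id k) (φ : V.Cell s k) :
    V.comp (LPath.nil a) s rfl rfl η (post φ θ) = φ := by
  refine (comp_swap (LPath.nil a) (l := LPath.nil a) (r := LPath.nil b) (x := e ::: LPath.one k)
    (y := LPath.one k) (y' := e ::: s) (z := s) (L₁ := LPath.one e) (L₂ := LPath.nil a)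
    (R₁ := LPath.one k) (R₂ := s) rfl rfl rfl (by simp) rfl rfl rfl (by simp) rfl (by simp) rfl rfl
    η φ θ).symm.trans ?_
  exact (congrArg (V.comp (LPath.nil a) (LPath.nil b) rfl (by simp) φ) h).trans (V.comp_id _ _ _)

/-- Substitution of a composite `post ψ θ` in the first entry of a 2-cell. -/
theorem post_right {a b c d : V.Obj} {p : V.Loose a b} {s : V.Path b c} {k : V.Loose b c}
    {t : V.Loose a c} {r : V.Path c d} {t' : V.Loose a d} {x y z : V.Path a d}
    (h : z = LPath.nil a +++ t ::: r) (h' : x = LPath.nil a +++ (p ::: s) +++ r)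
    (h₁ : z = LPath.nil a +++ t ::: r) (h₂ : y = LPath.nil a +++ (p ::: LPath.one k) +++ r)
    (h₃ : y = LPath.one p +++ k ::: r) (h₄ : x = LPath.one p +++ s +++ r)
    (ψ : V.Cell s k) (θ : V.Cell (p ::: LPath.one k) t) (ω : V.Cell z t') :
    V.comp (LPath.nil a) r h h' (post ψ θ) ω
      = V.comp (LPath.one p) r h₃ h₄ ψ (V.comp (LPath.nil a) r h₁ h₂ θ ω) :=
  comp_comp _ _ _ _ rfl rfl _ _ _ _ _ _ _ ψ θ ω

end VirtualBicategory

/-! ### Pointwise right lifts -/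

section

variable {V : VirtualBicategory.{w, v, t}}

/-- A family of 2-cells `p(x, y), s ⇒ q(x, z)` that is compatible with the left actions. -/
def IsNatural {A B C : VCat.{u} V} (p : VDist A B) {b : V.Obj} (y : B.Ob b) (q : VDist A C)
    {c : V.Obj} (z : C.Ob c) {s : V.Path b c}
    (θ : ∀ ⦃a : V.Obj⦄ (x : A.Ob a), V.Cell (p.Hom x y ::: s) (q.Hom x z)) : Prop :=
  ∀ ⦃a a' : V.Obj⦄ (x : A.Ob a) (x' : A.Ob a'),
    V.comp (y := A.Hom x x' ::: p.Hom x' y ::: s) (LPath.nil a) s rfl rfl (p.actL x x' y) (θ x)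
      = V.comp (LPath.one (A.Hom x x')) (LPath.nil c) rfl (by simp) (θ x') (q.actL x x' z)

/-- The substitution takes place to the right of `p(x, y)`, so it commutes with the left actions by
interchange and associativity. -/
theorem IsNatural.post {A B C : VCat.{u} V} {p : VDist A B} {b : V.Obj} {y : B.Ob b} {q : VDist A C}
    {c : V.Obj} {z : C.Ob c} {k : V.Loose b c}
    {ϖ : ∀ ⦃a : V.Obj⦄ (x : A.Ob a), V.Cell (p.Hom x y ::: LPath.one k) (q.Hom x z)}
    (h : IsNatural p y q z ϖ) {s : V.Path b c} (ψ : V.Cell s k) :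
    IsNatural p y q z (fun _ x => VirtualBicategory.post ψ (ϖ x)) := by
  intro a a' x x'
  refine (comp_post (y := A.Hom x x' ::: p.Hom x' y ::: LPath.one k)
    rfl rfl rfl rfl rfl (by simp) (p.actL x x' y) ψ (ϖ x)).trans ?_
  refine (congrArg _ (h x x')).trans ?_
  exact (comp_comp (y := A.Hom x x' ::: p.Hom x' y ::: LPath.one k)
    (LPath.one (A.Hom x x')) (LPath.nil c) (LPath.one (p.Hom x' y)) (LPath.nil c) rfl rfl rfl
    (by simp) rfl rfl rfl (by simp) (by simp) ψ (ϖ x') (q.actL x x' z)).symm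

/-- The loose-cell `k` with the natural family `ϖ` of 2-cells `p(x, y), k ⇒ q(x, z)` is universal
among the chains `s` with a natural family of 2-cells `p(x, y), s ⇒ q(x, z)`. -/
structure IsLiftAt {A B C : VCat.{u} V} (p : VDist A B) {b : V.Obj} (y : B.Ob b) (q : VDist A C)
    {c : V.Obj} (z : C.Ob c) (k : V.Loose b c)
    (ϖ : ∀ ⦃a : V.Obj⦄ (x : A.Ob a), V.Cell (p.Hom x y ::: LPath.one k) (q.Hom x z)) : Prop where
  natural : IsNatural p y q z ϖ
  exists_post : ∀ {s : V.Path b c}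
    (θ : ∀ ⦃a : V.Obj⦄ (x : A.Ob a), V.Cell (p.Hom x y ::: s) (q.Hom x z)),
    IsNatural p y q z θ → ∃ ψ : V.Cell s k, ∀ ⦃a : V.Obj⦄ (x : A.Ob a), post ψ (ϖ x) = θ x
  ext : ∀ {s : V.Path b c} (ψ ψ' : V.Cell s k),
    (∀ ⦃a : V.Obj⦄ (x : A.Ob a), post ψ (ϖ x) = post ψ' (ϖ x)) → ψ = ψ'

/-- Only naturality at position 0 is used here. The other positions matter when the pointwise
factorizations are assembled. -/
theorem VTrans.isNatural {A B C : VCat.{u} V} {p : VDist A B} {r : VChain B C} {q : VDist A C}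
    (φ : VTrans (p ::: r) q) {b c : V.Obj} {y : B.Ob b} {z : C.Ob c} (ys : Pts r y z) :
    IsNatural p y q z (fun _ x => φ.app (Pts.cons x ys)) :=
  fun _ _ x x' => (φ.natural (Ins.here x (Pts.cons x' ys))).symm

/-- This is naturality of `ϖ` at its middle position: `B(y, y')` may act on `l` from the left or on
`p` from the right. -/
theorem VTrans.post_actL {A B C : VCat.{u} V} {p : VDist A B} {q : VDist A C} {l : VDist B C}
    (ϖ : VTrans (p ::: LPath.one l) q) {a b b' c : V.Obj} (x : A.Ob a) (y : B.Ob b) (y' : B.Ob b')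
    (z : C.Ob c) {s : V.Path b' c} (ψ : V.Cell s (l.Hom y' z)) :
    post (post ψ (l.actL y y' z)) (ϖ.app (Pts.cons x (Pts.cons y (Pts.nil z))))
      = V.comp (y := p.Hom x y ::: B.Hom y y' ::: s) (LPath.nil a) s rfl rfl (p.actR x y y')
          (post ψ (ϖ.app (Pts.cons x (Pts.cons y' (Pts.nil z))))) := by
  refine (post_comp _ _ rfl (by simp) _ _ _).trans ?_
  refine Eq.trans ?_ (comp_post (y := p.Hom x y ::: B.Hom y y' ::: LPath.one (l.Hom y' z))
    rfl rfl rfl rfl rfl (by simp) (p.actR x y y') ψ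
    (ϖ.app (Pts.cons x (Pts.cons y' (Pts.nil z))))).symm
  exact congrArg _ (ϖ.natural (Ins.there x (Ins.here y (Pts.cons y' (Pts.nil z))))).symm

/-- This is naturality of `ϖ` at its last position: `C(z', z)` may act on `l` or on `q`. -/
theorem VTrans.post_actR {A B C : VCat.{u} V} {p : VDist A B} {q : VDist A C} {l : VDist B C}
    (ϖ : VTrans (p ::: LPath.one l) q) {a b c c' : V.Obj} (x : A.Ob a) (y : B.Ob b) (z' : C.Ob c')
    (z : C.Ob c) {s : V.Path b c'} {s' : V.Path b c} (h : s' = s +++ LPath.one (C.Hom z' z))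
    (ψ : V.Cell s (l.Hom y z')) :
    post (V.comp (y := s') (LPath.nil b) (LPath.one (C.Hom z' z)) rfl h ψ (l.actR y z' z))
        (ϖ.app (Pts.cons x (Pts.cons y (Pts.nil z))))
      = V.comp (s := p.Hom x y ::: s) (y := p.Hom x y ::: s') (LPath.nil a)
          (LPath.one (C.Hom z' z)) rfl (congrArg (LPath.cons (p.Hom x y)) h)
          (post ψ (ϖ.app (Pts.cons x (Pts.cons y (Pts.nil z'))))) (q.actR x z' z) := by
  subst h
  refine (post_comp _ _ rfl rfl _ _ _).trans ?_
  refine Eq.trans ?_ (post_right (y := p.Hom x y ::: l.Hom y z' ::: LPath.one (C.Hom z' z))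
    rfl rfl rfl rfl rfl rfl ψ (ϖ.app (Pts.cons x (Pts.cons y (Pts.nil z')))) (q.actR x z' z)).symm
  exact congrArg _ (ϖ.natural (Ins.there x (Ins.there y (Ins.here z' (Pts.nil z)))))

/-- The evaluation of a step on a family obtained by `post`. -/
theorem Step.post_eval {A B C : VCat.{u} V} {p : VDist A B} {q : VDist A C} {l : VDist B C}
    (ϖ : VTrans (p ::: LPath.one l) q) {r : VChain B C}
    (ψ : {b c : V.Obj} → {y : B.Ob b} → {z : C.Ob c} → (ys : Pts r y z) →
      V.Cell ys.path (l.Hom y z))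
    (φ : {a c : V.Obj} → {x : A.Ob a} → {z : C.Ob c} → (xs : Pts (p ::: r) x z) →
      V.Cell xs.path (q.Hom x z))
    (h : ∀ {a b c : V.Obj} (x : A.Ob a) {y : B.Ob b} {z : C.Ob c} (ys : Pts r y z),
      φ (Pts.cons x ys) = post (ψ ys) (ϖ.app (Pts.cons x (Pts.cons y (Pts.nil z)))))
    {a b c : V.Obj} (x : A.Ob a) {y : B.Ob b} {z : C.Ob c} {s : V.Path b c} (σ : Step r y z s) :
    post (σ.eval ψ) (ϖ.app (Pts.cons x (Pts.cons y (Pts.nil z)))) = (σ.cons x).eval φ := by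
  cases σ with
  | inner ys f =>
    change _ = (f.cons (p.Hom x y)).apply (φ (Pts.cons x ys))
    rw [h]
    exact f.post_apply _ _
  -- With `p` put in front, the left action on `l` is no longer an action on the target; `Step.cons`
  -- trades it for the right action on `p`.
  | @left b' y' ys =>
    change _ = V.comp (LPath.nil a) ys.path rfl rfl (p.actR x y y') (φ (Pts.cons x ys))
    rw [h]
    exact ϖ.post_actL x y y' z (ψ ys)
  | @right c' z' ys =>
    change _ = V.comp (LPath.nil a) (LPath.one (C.Hom z' z)) rfl rfl (φ (Pts.cons x ys))
      (q.actR x z' z)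
    rw [h]
    exact ϖ.post_actR x y z' z rfl (ψ ys)

/-- A pointwise right lift is a right lift. -/
theorem isRightLift_of_isLiftAt {A B C : VCat.{u} V} {p : VDist A B} {q : VDist A C}
    {l : VDist B C} (ϖ : VTrans (p ::: LPath.one l) q)
    (h : ∀ {b c : V.Obj} (y : B.Ob b) (z : C.Ob c), IsLiftAt p y q z (l.Hom y z)
      (fun _ x => ϖ.app (Pts.cons x (Pts.cons y (Pts.nil z))))) : IsRightLift ϖ := by
  intro r φ
  -- The factorization is chosen separately for each family of objects; nothing relates the choices
  -- yet.
  choose ψ hψ using fun {b c : V.Obj} {y : B.Ob b} {z : C.Ob c} (ys : Pts r y z) =>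
    (h y z).exists_post _ (φ.isNatural ys)
  refine ⟨⟨fun {_ _ _ _} ys => ψ ys, fun {b c y z} i => ?_⟩,
    fun {_ _ _} x {_ _} ys => (hψ ys x).symm, ?_⟩
  -- By the uniqueness part of the pointwise lift, naturality of `ψ` at `i` may be tested after
  -- composing with `ϖ`, where it becomes naturality of `φ` one position further right.
  · refine (h y z).ext _ _ fun a x => ?_
    refine (Step.post_eval ϖ (fun {_ _ _ _} ys => ψ ys) φ.app
      (fun {_ _ _} x {_ _} ys => (hψ ys x).symm)
      x i.toLeft).trans (Eq.trans ?_ (Step.post_eval ϖ (fun {_ _ _ _} ys => ψ ys) φ.app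
      (fun {_ _ _} x {_ _} ys => (hψ ys x).symm) x i.toRight).symm)
    exact φ.natural (Ins.there x i)
  · intro ψ' h'
    ext b c y z ys
    exact (h y z).ext _ _ fun a x => ((hψ ys x).trans (h' x ys)).symm

end

/-! ### Insertion of units -/

section

variable {V : VirtualBicategory.{w, v, t}}

/-- The whiskered 2-cell is `φ`, whiskered by `l` and `r`. -/
inductive VirtualBicategory.Whisk.Is {b c : V.Obj} {s : V.Path b c} {q : V.Loose b c}
    (φ : V.Cell s q) : {a d : V.Obj} → V.Path a b → V.Path c d → {x y : V.Path a d} →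
    Whisk V x y → Prop
  | mk {a d : V.Obj} (l : V.Path a b) (r : V.Path c d) : Whisk.Is φ l r (Whisk.mk l φ r)

theorem VirtualBicategory.Whisk.Is.cons {b c : V.Obj} {s : V.Path b c} {q : V.Loose b c}
    {φ : V.Cell s q} {a a' d : V.Obj} {l : V.Path a b} {r : V.Path c d} {x y : V.Path a d}
    {f : Whisk V x y} (h : f.Is φ l r) (m : V.Loose a' a) : (f.cons m).Is φ (m ::: l) r := by
  cases h
  exact Is.mk (m ::: l) r

theorem VirtualBicategory.Whisk.Is.apply {b c : V.Obj} {s : V.Path b c} {q : V.Loose b c}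
    {φ : V.Cell s q} {a d : V.Obj} {l : V.Path a b} {r : V.Path c d} {x y : V.Path a d}
    {f : Whisk V x y} (h : f.Is φ l r) (h₁ : y = l +++ q ::: r) (h₂ : x = l +++ s +++ r)
    {k : V.Loose a d} (θ : V.Cell y k) : f.apply θ = V.comp l r h₁ h₂ φ θ := by
  cases h
  rfl

/-- Inserting the nullary 2-cell `η` between `l` and `r` in the source of the whiskered 2-cell
yields an identity. -/
inductive VirtualBicategory.Whisk.IsUnital {e : V.Obj} {k : V.Loose e e}
    (η : V.Cell (LPath.nil e) k) : {a d : V.Obj} → V.Path a e → V.Path e d →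
    {x y : V.Path a d} → Whisk V x y → Prop
  | mk {a b c d : V.Obj} (l : V.Path a b) (r : V.Path c d) (l' : V.Path b e) (r' : V.Path e c)
      {s : V.Path b c} {q : V.Loose b c} (φ : V.Cell s q) (h : s = l' +++ k ::: r')
      (h' : LPath.one q = l' +++ LPath.nil e +++ r') (hφ : V.comp l' r' h h' η φ = V.id q) :
      Whisk.IsUnital η (l +++ l') (r' +++ r) (Whisk.mk l φ r)

theorem VirtualBicategory.Whisk.IsUnital.cons {e : V.Obj} {k : V.Loose e e}
    {η : V.Cell (LPath.nil e) k} {a a' d : V.Obj} {l : V.Path a e} {r : V.Path e d}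
    {x y : V.Path a d} {f : Whisk V x y} (hf : f.IsUnital η l r) (m : V.Loose a' a) :
    (f.cons m).IsUnital η (m ::: l) r := by
  cases hf with
  | mk l r l' r' φ h h' hφ => exact IsUnital.mk (m ::: l) r l' r' φ h h' hφ

theorem VirtualBicategory.Whisk.IsUnital.comp_apply {e : V.Obj} {k : V.Loose e e}
    {η : V.Cell (LPath.nil e) k} {a d : V.Obj} {l : V.Path a e} {r : V.Path e d}
    {x y : V.Path a d} {f : Whisk V x y} (hf : f.IsUnital η l r) (h : x = l +++ k ::: r)
    (h' : y = l +++ LPath.nil e +++ r) {t : V.Loose a d} (θ : V.Cell y t) :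
    V.comp l r h h' η (f.apply θ) = θ := by
  cases hf with
  | mk l r l' r' φ h₁ h₁' hφ =>
    refine (comp_comp _ _ _ _ rfl rfl h₁ h₁' rfl rfl h rfl h' η φ θ).symm.trans ?_
    rw [hφ]
    exact V.id_comp l r _ _ θ

/-- Inserting the nullary 2-cell `η` between `l` and `r` in the evaluation of the step yields the
member of the family at `xs`. -/
inductive Step.IsUnital : {C D : VCat.{u} V} → {r : VChain C D} → {a b : V.Obj} →
    {x : C.Ob a} → {y : D.Ob b} → {e : V.Obj} → {k : V.Loose e e} → V.Cell (LPath.nil e) k →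
    Pts r x y → V.Path a e → V.Path e b → {s : V.Path a b} → Step r x y s → Prop
  | inner {C D : VCat.{u} V} {r : VChain C D} {a b : V.Obj} {x : C.Ob a} {y : D.Ob b} {e : V.Obj}
      {k : V.Loose e e} {η : V.Cell (LPath.nil e) k} (xs : Pts r x y) {l : V.Path a e}
      {l' : V.Path e b} {s : V.Path a b} {f : Whisk V s xs.path} (hf : f.IsUnital η l l') :
      Step.IsUnital η xs l l' (Step.inner xs f)
  | left {C D : VCat.{u} V} {r : VChain C D} {a b : V.Obj} {x : C.Ob a} {y : D.Ob b}
      (xs : Pts r x y) : Step.IsUnital (C.one x) xs (LPath.nil a) xs.path (Step.left xs)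
  | right {C D : VCat.{u} V} {r : VChain C D} {a b : V.Obj} {x : C.Ob a} {y : D.Ob b}
      (xs : Pts r x y) : Step.IsUnital (D.one y) xs xs.path (LPath.nil b) (Step.right xs)

/-- Only the case `left` has content: the left action becomes the right action on `p`, whose unit
law is then needed. -/
theorem Step.IsUnital.cons {C D E : VCat.{u} V} {p : VDist C D} {r : VChain D E} {a b c : V.Obj}
    (x : C.Ob a) {y : D.Ob b} {z : E.Ob c} {e : V.Obj} {k : V.Loose e e}
    {η : V.Cell (LPath.nil e) k} {ys : Pts r y z} {l : V.Path b e} {l' : V.Path e c}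
    {s : V.Path b c} {σ : Step r y z s} (h : σ.IsUnital η ys l l') :
    (σ.cons (p := p) x).IsUnital η (Pts.cons (p := p) x ys) (p.Hom x y ::: l) l' := by
  cases h with
  | inner _ hf => exact IsUnital.inner (Pts.cons x ys) (hf.cons _)
  | left =>
    exact IsUnital.inner (Pts.cons x ys) (Whisk.IsUnital.mk (LPath.nil a) ys.path
      (LPath.one (p.Hom x y)) (LPath.nil b) (p.actR x y y) rfl rfl (p.actR_one x y))
  | right => exact IsUnital.right (Pts.cons x ys)

/-- When the action is on `q`, interchange brings the identity next to the action, and the unit law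
of `q` cancels both. -/
theorem Step.IsUnital.comp_eval {C D : VCat.{u} V} {r : VChain C D} {q : VDist C D}
    (φ : {a b : V.Obj} → {x : C.Ob a} → {y : D.Ob b} → (xs : Pts r x y) →
      V.Cell xs.path (q.Hom x y)) {a b : V.Obj} {x : C.Ob a} {y : D.Ob b} {e : V.Obj}
    {k : V.Loose e e} {η : V.Cell (LPath.nil e) k} {xs : Pts r x y} {l : V.Path a e}
    {l' : V.Path e b} {s : V.Path a b} {σ : Step r x y s} (hσ : σ.IsUnital η xs l l')
    (h : s = l +++ k ::: l') (h' : xs.path = l +++ LPath.nil e +++ l') :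
    V.comp l l' h h' η (σ.eval φ) = φ xs := by
  cases hσ with
  | inner _ hf => exact hf.comp_apply h h' (φ xs)
  | left =>
    refine (comp_swap (LPath.nil a) (L₁ := LPath.one (C.Hom x x)) (L₂ := LPath.nil a)
      (R₁ := LPath.one (q.Hom x y)) (y := LPath.one (q.Hom x y)) rfl rfl rfl (by simp) rfl rfl rfl
      (by simp) rfl (by simp) h h' (C.one x) (φ xs) (q.actL x x y)).symm.trans ?_
    exact (congrArg (V.comp (LPath.nil a) (LPath.nil b) rfl (by simp) (φ xs))
      (q.one_actL x y)).trans (V.comp_id _ _ _)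
  | right =>
    refine (comp_swap (LPath.nil b) (l := LPath.nil a) (L₁ := LPath.one (q.Hom x y)) (L₂ := xs.path)
      (R₁ := LPath.one (D.Hom y y)) (R₂ := LPath.nil b) (y' := LPath.one (q.Hom x y))
      rfl (by simp) rfl rfl rfl h h h' rfl rfl rfl (by simp) (φ xs) (D.one y)
      (q.actR x y y)).trans ?_
    exact (congrArg (V.comp (LPath.nil a) (LPath.nil b) rfl (by simp) (φ xs))
      (q.actR_one x y)).trans (V.comp_id _ _ _)

/-- The two objects chosen at one position are equal: inserting the identity `η` of this object
between `l` and `r` yields the chain of `xs`. -/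
inductive Ins.IsDiag : {C D : VCat.{u} V} → {r : VChain C D} → {a b : V.Obj} →
    {x : C.Ob a} → {y : D.Ob b} → {e : V.Obj} → {k : V.Loose e e} → V.Cell (LPath.nil e) k →
    Pts r x y → V.Path a e → V.Path e b → Ins r x y → Prop
  | here {C D : VCat.{u} V} {r : VChain C D} {a b : V.Obj} {x : C.Ob a} {y : D.Ob b}
      (xs : Pts r x y) : Ins.IsDiag (C.one x) xs (LPath.nil a) xs.path (Ins.here x xs)
  | there {C D E : VCat.{u} V} {p : VDist C D} {r : VChain D E} {a b c : V.Obj} (x : C.Ob a)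
      {y : D.Ob b} {z : E.Ob c} {e : V.Obj} {k : V.Loose e e} {η : V.Cell (LPath.nil e) k}
      {ys : Pts r y z} {l : V.Path b e} {l' : V.Path e c} {i : Ins r y z}
      (h : Ins.IsDiag η ys l l' i) :
      Ins.IsDiag η (Pts.cons (p := p) x ys) (p.Hom x y ::: l) l' (Ins.there x i)

namespace Ins.IsDiag

variable {C D : VCat.{u} V} {r : VChain C D} {a b : V.Obj} {x : C.Ob a} {y : D.Ob b} {e : V.Obj}
  {k : V.Loose e e} {η : V.Cell (LPath.nil e) k} {xs : Pts r x y} {l : V.Path a e}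
  {l' : V.Path e b} {i : Ins r x y}

theorem path_eq (h : i.IsDiag η xs l l') : i.path = l +++ k ::: l' := by
  induction h with
  | here xs => rfl
  | @there _ _ _ p _ _ _ _ x y _ _ _ _ _ _ _ _ _ ih => exact congrArg (LPath.cons (p.Hom x y)) ih

theorem pts_path_eq (h : i.IsDiag η xs l l') : xs.path = l +++ LPath.nil e +++ l' := by
  induction h with
  | here xs => rfl
  | @there _ _ _ p _ _ _ _ x y _ _ _ _ _ _ _ _ _ ih => exact congrArg (LPath.cons (p.Hom x y)) ih

theorem toLeft (h : i.IsDiag η xs l l') : i.toLeft.IsUnital η xs l l' := by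
  induction h with
  | here xs => exact Step.IsUnital.left xs
  | there x _ ih => exact ih.cons x

/-- At the end of the chain the identity acts on the target; otherwise it acts on the next
distributor, and the unit law of its left action applies. -/
theorem toRight (h : i.IsDiag η xs l l') : i.toRight.IsUnital η xs l l' := by
  induction h with
  | @here _ _ _ a _ x _ xs =>
    cases xs with
    | nil => exact Step.IsUnital.right (Pts.nil x)
    | @cons _ _ _ p _ _ _ _ _ y _ ys =>
      exact Step.IsUnital.inner (Pts.cons x ys) (Whisk.IsUnital.mk (LPath.nil a) ys.path
        (LPath.nil a) (LPath.one (p.Hom x y)) (p.actL x x y) rfl rfl (p.one_actL x y))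
  | there x _ ih => exact ih.cons x

/-- Naturality holds at a position where the identity is opcartesian. -/
theorem eval_eq (h : i.IsDiag η xs l l')
    (hη : ∀ {t : V.Loose a b} (θ θ' : V.Cell (l +++ k ::: l') t),
      V.comp (y := l +++ l') l l' rfl rfl η θ = V.comp (y := l +++ l') l l' rfl rfl η θ' → θ = θ')
    {q : VDist C D} (φ : {a b : V.Obj} → {x : C.Ob a} → {y : D.Ob b} → (xs : Pts r x y) →
      V.Cell xs.path (q.Hom x y)) : i.toLeft.eval φ = i.toRight.eval φ := by
  have key : ∀ {s s' : V.Path a b} (h₁ : s = l +++ k ::: l') (h₂ : s' = l +++ LPath.nil e +++ l')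
      (θ θ' : V.Cell s (q.Hom x y)), V.comp l l' h₁ h₂ η θ = V.comp l l' h₁ h₂ η θ' → θ = θ' := by
    rintro _ _ rfl rfl θ θ' h
    exact hη θ θ' h
  -- Inserting `η` reduces both sides to `φ xs`, and insertion of `η` is injective by `hη`.
  exact key h.path_eq h.pts_path_eq _ _ ((h.toLeft.comp_eval φ _ _).trans
    (h.toRight.comp_eval φ _ _).symm)

/-- Naturality holds at the object of a one-object `V`-category `⋆ₑ`. -/
theorem eval_eq_of_eta [V.Normal] {e : V.Obj} {l : V.Path a e} {l' : V.Path e b}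
    (h : i.IsDiag (Normal.eta e) xs l l') {q : VDist C D}
    (φ : {a b : V.Obj} → {x : C.Ob a} → {y : D.Ob b} → (xs : Pts r x y) →
      V.Cell xs.path (q.Hom x y)) : i.toLeft.eval φ = i.toRight.eval φ :=
  h.eval_eq (fun _ _ => Normal.ext l l') φ

end Ins.IsDiag

/-- Case distinction for a position in a nonempty chain. -/
theorem Ins.cons_cases {C D E : VCat.{u} V} {p : VDist C D} {r : VChain D E} {a c : V.Obj}
    {x : C.Ob a} {z : E.Ob c} {motive : Ins (p ::: r) x z → Prop}
    (here : ∀ {a' b : V.Obj} (x' : C.Ob a') {y : D.Ob b} (ys : Pts r y z),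
      motive (Ins.here x (Pts.cons x' ys)))
    (there : ∀ {b : V.Obj} {y : D.Ob b} (i : Ins r y z), motive (Ins.there x i))
    (i : Ins (p ::: r) x z) : motive i := by
  cases i with
  | here _ xs =>
    cases xs with
    | cons _ ys => exact here _ ys
  | there _ i => exact there i

theorem Ins.nil_cases {C : VCat.{u} V} {a b : V.Obj} {x : C.Ob a} {y : C.Ob b}
    {motive : Ins (LPath.nil C) x y → Prop} (here : motive (Ins.here x (Pts.nil y)))
    (i : Ins (LPath.nil C) x y) : motive i := by
  cases i with
  | here _ xs =>
    cases xs with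
    | nil => exact here

end

/-! ### Composites of natural transformations -/

section

variable {V : VirtualBicategory.{w, v, t}}

/-- The underlying family of 2-cells of `VTrans.postcomp`. -/
def VTrans.postcompApp {A B C : VCat.{u} V} {p : VDist A B} {q : VDist A C} {l : VDist B C}
    (ϖ : VTrans (p ::: LPath.one l) q) {r : VChain B C} (ψ : VTrans r l) :
    {a c : V.Obj} → {x : A.Ob a} → {z : C.Ob c} → (xs : Pts (p ::: r) x z) →
      V.Cell xs.path (q.Hom x z)
  | _, _, _, _, Pts.cons (y := y) (z := z) x ys =>
    post (ψ.app ys) (ϖ.app (Pts.cons x (Pts.cons y (Pts.nil z))))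

/-- The composite `p, r₁, …, rₙ ⇒ p, l ⇒ q` of `V`-natural transformations. -/
def VTrans.postcomp {A B C : VCat.{u} V} {p : VDist A B} {q : VDist A C} {l : VDist B C}
    (ϖ : VTrans (p ::: LPath.one l) q) {r : VChain B C} (ψ : VTrans r l) : VTrans (p ::: r) q where
  app := ϖ.postcompApp ψ
  natural := fun {a c x z} i => by
    cases i using Ins.cons_cases with
    | @here a' b x' y ys =>
      exact (IsNatural.post (ϖ.isNatural (Pts.cons y (Pts.nil z))) (ψ.app ys) x x').symm
    | there i =>
      -- A position after `p` is a position of `ψ`, so naturality of `ψ` suffices.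
      refine (Step.post_eval ϖ ψ.app (ϖ.postcompApp ψ) (fun {_ _ _} _ {_ _} _ => rfl) x
        i.toLeft).symm.trans (Eq.trans ?_ (Step.post_eval ϖ ψ.app (ϖ.postcompApp ψ)
        (fun {_ _ _} _ {_ _} _ => rfl) x i.toRight))
      exact congrArg (fun χ => post χ _) (ψ.natural i)

/-- The action of `B` on `p` as a `V`-natural transformation `p, B(1, f) ⇒ p(1, f)`. -/
def VDist.restrictTrans {A B C : VCat.{u} V} (p : VDist A B) (f : VFunctor C B) :
    VTrans (p ::: LPath.one (B.idDist.restrict f)) (p.restrict f) where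
  app := fun {_ _ _ _} xs => match xs with
    | Pts.cons x (Pts.cons y (Pts.nil z)) => p.actR x y (f.obj z)
  natural := fun {_ _ _ _} i => by
    match i with
    | Ins.here x (Pts.cons x' (Pts.cons y (Pts.nil z))) =>
      exact (p.actL_actR x x' y (f.obj z)).symm
    | Ins.there x (Ins.here y (Pts.cons y' (Pts.nil z))) => exact p.actR_mul x y y' (f.obj z)
    | Ins.there x (Ins.there y (Ins.here z (Pts.nil z'))) =>
      -- Once `f.map` is moved outside both composites, what remains is associativity of the right
      -- action on `p`.
      change post (post (f.map z z') (B.mul y (f.obj z) (f.obj z'))) (p.actR x y (f.obj z')) = _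
      refine (post_comp _ _ rfl rfl _ _ _).trans ?_
      refine Eq.trans ?_ (comp_post (y := p.Hom x y ::: B.Hom y (f.obj z) :::
        LPath.one (B.Hom (f.obj z) (f.obj z'))) rfl rfl rfl rfl rfl rfl
        (p.actR x y (f.obj z)) (f.map z z') (p.actR x (f.obj z) (f.obj z'))).symm
      exact congrArg _ (p.actR_mul x y (f.obj z) (f.obj z')).symm

theorem VirtualBicategory.Whisk.comp_apply_cons {a b c d : V.Obj} {p : V.Loose a b}
    {m₁ : V.Loose a c} {m₂ : V.Loose c b} {s s' : V.Path b d} (f : Whisk V s s')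
    {t : V.Loose a d} (μ : V.Cell (m₁ ::: LPath.one m₂) p) (θ : V.Cell (p ::: s') t) :
    ((f.cons m₂).cons m₁).apply (V.comp (y := m₁ ::: m₂ ::: s') (LPath.nil a) s' rfl rfl μ θ)
      = V.comp (LPath.nil a) s rfl rfl μ ((f.cons p).apply θ) := by
  cases f with
  | mk l φ r => exact comp_swap (l := LPath.nil a) l rfl rfl rfl rfl _ _ _ _ _ _ _ _ μ φ θ

/-- The underlying family of 2-cells of `VTrans.precomp`. -/
def VTrans.precompApp {A B C D : VCat.{u} V} {p : VDist A B} {p' : VDist B C} {p'' : VDist A C}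
    (μ : VTrans (p ::: LPath.one p') p'') {r : VChain C D} {q : VDist A D}
    (Θ : VTrans (p'' ::: r) q) : {a d : V.Obj} → {x : A.Ob a} → {w : D.Ob d} →
      (xs : Pts (p ::: p' ::: r) x w) → V.Cell xs.path (q.Hom x w)
  | a, _, _, _, Pts.cons x (Pts.cons (y := z) y zs) =>
    V.comp (LPath.nil a) zs.path rfl rfl (μ.app (Pts.cons x (Pts.cons y (Pts.nil z))))
      (Θ.app (Pts.cons x zs))

/-- A position beyond `p'` in `p, p', r` is a position beyond `p''` in `p'', r`. At the boundary
(case `left`) the hom-morphism acts on `p'` instead of `p''`, and naturality of `μ` at its last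
position compares the two. -/
theorem Step.precomp_eval {A B C D : VCat.{u} V} {p : VDist A B} {p' : VDist B C}
    {p'' : VDist A C} (μ : VTrans (p ::: LPath.one p') p'') {r : VChain C D} {q : VDist A D}
    (Θ : VTrans (p'' ::: r) q) {a b c d : V.Obj} (x : A.Ob a) (y : B.Ob b) {z : C.Ob c}
    {w : D.Ob d} {s : V.Path c d} (σ : Step r z w s) :
    ((σ.cons (p := p') y).cons (p := p) x).eval (μ.precompApp Θ)
      = V.comp (y := p.Hom x y ::: p'.Hom y z ::: s) (LPath.nil a) s rfl rfl
          (μ.app (Pts.cons x (Pts.cons y (Pts.nil z)))) ((σ.cons (p := p'') x).eval Θ.app) := by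
  cases σ with
  | inner zs f => exact f.comp_apply_cons _ _
  | @left c' z' zs =>
    refine (comp_comp (y := p.Hom x y ::: p'.Hom y z' ::: zs.path)
      (z := p.Hom x y ::: p'.Hom y z ::: C.Hom z z' ::: zs.path)
      (LPath.nil a) zs.path (LPath.one (p.Hom x y)) (LPath.nil c')
      rfl rfl rfl rfl rfl rfl rfl rfl rfl (p'.actR y z z')
      (μ.app (Pts.cons x (Pts.cons y (Pts.nil z')))) (Θ.app (Pts.cons x zs))).symm.trans ?_
    refine Eq.trans ?_ (comp_comp (y := p''.Hom x z ::: C.Hom z z' ::: zs.path)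
      (z := p.Hom x y ::: p'.Hom y z ::: C.Hom z z' ::: zs.path)
      (LPath.nil a) zs.path (LPath.nil a) (LPath.one (C.Hom z z'))
      rfl rfl rfl rfl rfl rfl rfl rfl rfl (μ.app (Pts.cons x (Pts.cons y (Pts.nil z))))
      (p''.actR x z z') (Θ.app (Pts.cons x zs)))
    exact congrArg (fun χ => V.comp (LPath.nil a) zs.path rfl rfl χ (Θ.app (Pts.cons x zs)))
      (μ.natural (Ins.there x (Ins.there y (Ins.here z (Pts.nil z')))))
  | @right d' w' zs =>
    exact comp_comp (y := p''.Hom x z ::: (zs.path +++ LPath.one (D.Hom w' w)))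
      (z := p.Hom x y ::: p'.Hom y z ::: (zs.path +++ LPath.one (D.Hom w' w)))
      (LPath.nil a) (LPath.one (D.Hom w' w)) (LPath.nil a) zs.path
      rfl rfl rfl rfl rfl rfl rfl rfl rfl (μ.app (Pts.cons x (Pts.cons y (Pts.nil z))))
      (Θ.app (Pts.cons x zs)) (q.actR x w' w)

/-- The composite `p, p', r₁, …, rₙ ⇒ p'', r₁, …, rₙ ⇒ q` of `V`-natural transformations. -/
def VTrans.precomp {A B C D : VCat.{u} V} {p : VDist A B} {p' : VDist B C} {p'' : VDist A C}
    (μ : VTrans (p ::: LPath.one p') p'') {r : VChain C D} {q : VDist A D}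
    (Θ : VTrans (p'' ::: r) q) : VTrans (p ::: p' ::: r) q where
  app := μ.precompApp Θ
  natural := fun {a d x w} i => by
    cases i using Ins.cons_cases with
    | @here a' _ x' y ys =>
      -- At position 0 the left action passes first through `Θ`, from `q` to `p''`, and then through
      -- `μ`, from `p''` to `p`.
      cases ys with
      | @cons _ _ _ _ _ b c _ _ z _ zs =>
        have e₁ := comp_comp (y := p.Hom x y ::: p'.Hom y z ::: zs.path)
          (z := A.Hom x x' ::: p.Hom x' y ::: p'.Hom y z ::: zs.path)
          (LPath.nil a) zs.path (LPath.nil a) (LPath.one (p'.Hom y z))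
          rfl rfl rfl rfl rfl rfl rfl rfl rfl (p.actL x x' y)
          (μ.app (Pts.cons x (Pts.cons y (Pts.nil z)))) (Θ.app (Pts.cons x zs))
        have e₂ := congrArg (fun χ => V.comp
          (y := A.Hom x x' ::: p.Hom x' y ::: p'.Hom y z ::: zs.path)
          (LPath.nil a) zs.path rfl rfl χ (Θ.app (Pts.cons x zs)))
          (μ.natural (Ins.here x (Pts.cons x' (Pts.cons y (Pts.nil z)))))
        have e₃ := comp_comp (y := A.Hom x x' ::: p''.Hom x' z ::: zs.path)
          (z := A.Hom x x' ::: p.Hom x' y ::: p'.Hom y z ::: zs.path)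
          (LPath.nil a) zs.path (LPath.one (A.Hom x x')) (LPath.nil c)
          rfl rfl rfl rfl rfl rfl rfl rfl rfl (μ.app (Pts.cons x' (Pts.cons y (Pts.nil z))))
          (p''.actL x x' z) (Θ.app (Pts.cons x zs))
        have e₄ := congrArg (V.comp (y := A.Hom x x' ::: p.Hom x' y ::: p'.Hom y z ::: zs.path)
          (LPath.one (A.Hom x x')) zs.path rfl rfl (μ.app (Pts.cons x' (Pts.cons y (Pts.nil z)))))
          (Θ.natural (Ins.here x (Pts.cons x' zs)))
        have e₅ := comp_comp (x := A.Hom x x' ::: LPath.one (q.Hom x' w))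
          (y := A.Hom x x' ::: p''.Hom x' z ::: zs.path)
          (z := A.Hom x x' ::: p.Hom x' y ::: p'.Hom y z ::: zs.path)
          (LPath.one (A.Hom x x')) (LPath.nil d) (LPath.nil a') zs.path
          rfl (by simp) rfl rfl rfl (by simp) rfl (by simp [Pts.path]) rfl
          (μ.app (Pts.cons x' (Pts.cons y (Pts.nil z)))) (Θ.app (Pts.cons x' zs)) (q.actL x x' w)
        exact e₅.trans (e₄.trans (e₃.symm.trans (e₂.trans e₁)))
    | @there _ y i =>
      cases i using Ins.cons_cases with
      -- The position between `p` and `p'` is internal to `μ`, so `Θ` is only carried along.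
      | @here b' c y' z zs =>
        have e₁ := comp_comp (y := p.Hom x y' ::: p'.Hom y' z ::: zs.path)
          (z := p.Hom x y ::: B.Hom y y' ::: p'.Hom y' z ::: zs.path)
          (LPath.nil a) zs.path (LPath.nil a) (LPath.one (p'.Hom y' z))
          rfl rfl rfl rfl rfl rfl rfl rfl rfl (p.actR x y y')
          (μ.app (Pts.cons x (Pts.cons y' (Pts.nil z)))) (Θ.app (Pts.cons x zs))
        have e₂ := congrArg (fun χ => V.comp
          (y := p.Hom x y ::: B.Hom y y' ::: p'.Hom y' z ::: zs.path)
          (LPath.nil a) zs.path rfl rfl χ (Θ.app (Pts.cons x zs)))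
          (μ.natural (Ins.there x (Ins.here y (Pts.cons y' (Pts.nil z)))))
        have e₃ := comp_comp (y := p.Hom x y ::: p'.Hom y z ::: zs.path)
          (z := p.Hom x y ::: B.Hom y y' ::: p'.Hom y' z ::: zs.path)
          (LPath.nil a) zs.path (LPath.one (p.Hom x y)) (LPath.nil c)
          rfl rfl rfl rfl rfl rfl rfl rfl rfl (p'.actL y y' z)
          (μ.app (Pts.cons x (Pts.cons y (Pts.nil z)))) (Θ.app (Pts.cons x zs))
        exact e₁.symm.trans (e₂.trans e₃)
      | there i =>
        refine (Step.precomp_eval μ Θ x y i.toLeft).trans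
          (Eq.trans ?_ (Step.precomp_eval μ Θ x y i.toRight).symm)
        exact congrArg _ (Θ.natural (Ins.there x i))

end

/-! ### Distributors between one-object categories -/

section

variable {V : VirtualBicategory.{w, v, t}} [V.Normal]

namespace VirtualBicategory.Normal

/-- The left unitor `id, k ⇒ k`. -/
noncomputable def unitL {a b : V.Obj} (k : V.Loose a b) : V.Cell (idL a ::: LPath.one k) k :=
  (Normal.existsUnique (LPath.nil a) (LPath.one k) (V.id k)).choose

theorem eta_unitL {a b : V.Obj} (k : V.Loose a b) :
    V.comp (LPath.nil a) (LPath.one k) rfl rfl (eta a) (unitL k) = V.id k :=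
  (Normal.existsUnique (LPath.nil a) (LPath.one k) (V.id k)).choose_spec.1

/-- The right unitor `k, id ⇒ k`. -/
noncomputable def unitR {a b : V.Obj} (k : V.Loose a b) : V.Cell (k ::: LPath.one (idL b)) k :=
  (Normal.existsUnique (LPath.one k) (LPath.nil b) (V.id k)).choose

theorem eta_unitR {a b : V.Obj} (k : V.Loose a b) :
    V.comp (LPath.one k) (LPath.nil b) rfl rfl (eta b) (unitR k) = V.id k :=
  (Normal.existsUnique (LPath.one k) (LPath.nil b) (V.id k)).choose_spec.1

end VirtualBicategory.Normal

open VirtualBicategory.Normal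

/-- A family of loose-cells with an action of `C` on the right, as a `V`-distributor to a
one-object `V`-category. -/
noncomputable def VDist.ofRight {b : V.Obj} {C : VCat.{u} V}
    (Hom : ∀ {c : V.Obj}, C.Ob c → V.Loose b c)
    (act : ∀ {c c' : V.Obj} (z : C.Ob c) (z' : C.Ob c'),
      V.Cell (Hom z ::: LPath.one (C.Hom z z')) (Hom z'))
    (act_one : ∀ {c : V.Obj} (z : C.Ob c),
      V.comp (LPath.one (Hom z)) (LPath.nil c) rfl rfl (C.one z) (act z z) = V.id (Hom z))
    (act_mul : ∀ {c c' c'' : V.Obj} (z : C.Ob c) (z' : C.Ob c') (z'' : C.Ob c''),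
      V.comp (y := Hom z ::: C.Hom z z' ::: LPath.one (C.Hom z' z''))
          (LPath.nil b) (LPath.one (C.Hom z' z'')) rfl rfl (act z z') (act z' z'')
        = V.comp (LPath.one (Hom z)) (LPath.nil c'') rfl rfl (C.mul z z' z'') (act z z'')) :
    VDist (VCat.star.{u} V b) C where
  Hom x z := match x with
    | StarOb.pt => Hom z
  actL x x' z := match x, x' with
    | StarOb.pt, StarOb.pt => unitL (Hom z)
  actR x z z' := match x with
    | StarOb.pt => act z z'
  one_actL x z := match x with
    | StarOb.pt => eta_unitL (Hom z)
  mul_actL x x' x'' z := match x, x', x'' with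
    | StarOb.pt, StarOb.pt, StarOb.pt => by
      -- The nullary 2-cell `η` is opcartesian, so laws involving the action of the one-object
      -- category may be checked after inserting it, where the unitor cancels.
      apply Normal.ext (LPath.nil b) (idL b ::: LPath.one (Hom z))
      refine Eq.trans ?_ (comp_post_of_unit (eta_unitL (Hom z)) (unitL (Hom z))).symm
      refine (comp_comp (LPath.nil b) (LPath.one (Hom z)) (LPath.nil b) (LPath.one (idL b))
        rfl rfl rfl rfl rfl rfl rfl rfl rfl (eta b) (mulId b) (unitL (Hom z))).symm.trans ?_
      exact (congrArg (fun φ => V.comp (y := idL b ::: LPath.one (Hom z)) (LPath.nil b)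
        (LPath.one (Hom z)) rfl rfl φ (unitL (Hom z))) (eta_mulId b)).trans (V.id_comp _ _ _ _ _)
  actR_one x z := match x with
    | StarOb.pt => act_one z
  actR_mul x z z' z'' := match x with
    | StarOb.pt => act_mul z z' z''
  actL_actR x x' z z' := match x, x' with
    | StarOb.pt, StarOb.pt => by
      apply Normal.ext (LPath.nil b) (Hom z ::: LPath.one (C.Hom z z'))
      refine Eq.trans ?_ (comp_post_of_unit (eta_unitL (Hom z')) (act z z')).symm
      refine (comp_comp (LPath.nil b) (LPath.one (C.Hom z z')) (LPath.nil b) (LPath.one (Hom z))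
        rfl rfl rfl rfl rfl rfl rfl rfl rfl (eta b) (unitL (Hom z)) (act z z')).symm.trans ?_
      exact (congrArg (fun φ => V.comp (y := Hom z ::: LPath.one (C.Hom z z')) (LPath.nil b)
        (LPath.one (C.Hom z z')) rfl rfl φ (act z z')) (eta_unitL (Hom z))).trans
        (V.id_comp _ _ _ _ _)

/-- A loose-cell as a `V`-distributor between one-object `V`-categories. -/
noncomputable def VDist.ofLoose {b c : V.Obj} (k : V.Loose b c) :
    VDist (VCat.star.{u} V b) (VCat.star.{u} V c) :=
  VDist.ofRight (C := VCat.star.{u} V c)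
    (fun {_} z => match z with
      | StarOb.pt => k)
    (fun {_ _} z z' => match z, z' with
      | StarOb.pt, StarOb.pt => unitR k)
    (fun {_} z => match z with
      | StarOb.pt => eta_unitR k)
    (fun {_ _ _} z z' z'' => match z, z', z'' with
      | StarOb.pt, StarOb.pt, StarOb.pt => by
        apply Normal.ext (LPath.one k) (LPath.one (idL c))
        have e₁ := comp_comp (x := k ::: LPath.one (idL c)) (y := k ::: idL c ::: LPath.one (idL c))
          (z := k ::: LPath.one (idL c))
          (LPath.nil b) (LPath.one (idL c)) (LPath.one k) (LPath.nil c)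
          rfl rfl rfl rfl rfl rfl rfl rfl rfl (eta c) (unitR k) (unitR k)
        have e₂ := comp_comp (x := k ::: LPath.one (idL c)) (y := k ::: idL c ::: LPath.one (idL c))
          (z := k ::: LPath.one (idL c))
          (LPath.one k) (LPath.nil c) (LPath.nil c) (LPath.one (idL c))
          rfl rfl rfl rfl rfl rfl rfl rfl rfl (eta c) (mulId c) (unitR k)
        refine e₁.symm.trans (Eq.trans ?_ e₂)
        refine (congrArg (fun χ => V.comp (y := k ::: LPath.one (idL c)) (LPath.nil b)
          (LPath.one (idL c)) rfl rfl χ (unitR k)) (eta_unitR k)).trans (Eq.trans ?_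
          (congrArg (fun χ => V.comp (y := k ::: LPath.one (idL c)) (LPath.one k)
          (LPath.nil c) rfl rfl χ (unitR k)) (eta_mulId c)).symm)
        exact (V.id_comp _ _ _ _ _).trans (V.id_comp _ _ _ _ _).symm)

/-- The `V`-distributor `C(z, 1)`. -/
noncomputable def VCat.corepr (C : VCat.{u} V) {c : V.Obj} (z : C.Ob c) :
    VDist (VCat.star.{u} V c) C :=
  VDist.ofRight (fun {_} w => C.Hom z w) (fun {_ _} w w' => C.mul z w w')
    (fun {_} w => C.mul_one z w) (fun {_ _ _} w w' w'' => C.assoc z w w' w'')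

/-- A chain of loose-cells, followed by `C(z, 1)`, as a chain of `V`-distributors. -/
noncomputable def VCat.chainTo (C : VCat.{u} V) : {b c : V.Obj} → V.Path b c → C.Ob c →
    VChain (VCat.star.{u} V b) C
  | _, _, LPath.nil _, z => LPath.one (C.corepr z)
  | _, _, LPath.cons k s, z => VDist.ofLoose k ::: C.chainTo s z

end

/-! ### Right lifts are pointwise -/

section

variable {V : VirtualBicategory.{w, v, t}}

theorem VirtualBicategory.Whisk.Is.source_eq {b c : V.Obj} {s : V.Path b c} {q : V.Loose b c}
    {φ : V.Cell s q} {a d : V.Obj} {l : V.Path a b} {r : V.Path c d} {x y : V.Path a d}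
    {f : Whisk V x y} (h : f.Is φ l r) : x = l +++ s +++ r := by
  cases h
  rfl

/-- The step applies the right action to the member of the family at `ys`. -/
inductive Step.IsRight {C D : VCat.{u} V} {r : VChain C D} {a b b' : V.Obj} {x : C.Ob a}
    {y : D.Ob b} {y' : D.Ob b'} (ys : Pts r x y') : {s : V.Path a b} → Step r x y s → Prop
  | mk : Step.IsRight ys (Step.right ys)

theorem Step.IsRight.cons {C D E : VCat.{u} V} {p : VDist C D} {r : VChain D E}
    {a b c c' : V.Obj} (x : C.Ob a) {y : D.Ob b} {z : E.Ob c} {z' : E.Ob c'} {ys : Pts r y z'}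
    {s : V.Path b c} {σ : Step r y z s} (h : σ.IsRight ys) :
    (σ.cons (p := p) x).IsRight (Pts.cons (p := p) x ys) := by
  cases h
  exact IsRight.mk

theorem Step.IsRight.eval_eq {C D : VCat.{u} V} {r : VChain C D} {q : VDist C D}
    (φ : {a b : V.Obj} → {x : C.Ob a} → {y : D.Ob b} → (xs : Pts r x y) →
      V.Cell xs.path (q.Hom x y)) {a b b' : V.Obj} {x : C.Ob a}
    {y : D.Ob b} {y' : D.Ob b'} {ys : Pts r x y'} {s : V.Path a b} {σ : Step r x y s}
    (hσ : σ.IsRight ys) (h : s = LPath.nil a +++ ys.path +++ LPath.one (D.Hom y' y)) :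
    σ.eval φ = V.comp (LPath.nil a) (LPath.one (D.Hom y' y)) rfl h (φ ys) (q.actR x y' y) := by
  cases hσ
  rfl

variable [V.Normal]

namespace VCat

variable {C : VCat.{u} V}

/-- Case distinction for a position in the chain `C.chainTo s z`: either it belongs to a one-object
`V`-category, or it is the last one. -/
theorem chainTo_cases {b c d : V.Obj} (s : V.Path b c) (z : C.Ob c) {w : C.Ob d}
    (i : Ins (C.chainTo s z) StarOb.pt w) :
    (∃ (e : V.Obj) (ys : Pts (C.chainTo s z) StarOb.pt w) (l : V.Path b e) (l' : V.Path e d),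
      i.IsDiag (Normal.eta e) ys l l') ∨
    ∃ (d' : V.Obj) (w' : C.Ob d') (ys : Pts (C.chainTo s z) StarOb.pt w)
      (ys' : Pts (C.chainTo s z) StarOb.pt w') (f : Whisk V i.path ys.path),
      i.toLeft = Step.inner ys f ∧ f.Is (C.mul z w' w) s (LPath.nil d) ∧ i.toRight.IsRight ys' := by
  induction s with
  | nil c =>
    change Ins (C.corepr z ::: LPath.nil C) StarOb.pt w at i
    cases i using Ins.cons_cases with
    | here x' ys =>
      cases x'
      exact Or.inl ⟨c, _, _, _, Ins.IsDiag.here (C := VCat.star V c) (x := StarOb.pt) _⟩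
    | @there d' w' i =>
      cases i using Ins.nil_cases
      exact Or.inr ⟨d', w', _, _, _, rfl, Whisk.Is.mk _ _, Step.IsRight.mk⟩
  | cons k s ih =>
    change Ins (VDist.ofLoose k ::: C.chainTo s z) StarOb.pt w at i
    cases i using Ins.cons_cases with
    | here x' ys =>
      cases x'
      exact Or.inl ⟨_, _, _, _, Ins.IsDiag.here (C := VCat.star V _) (x := StarOb.pt) _⟩
    | @there _ y i =>
      cases y
      rcases ih z i with ⟨e, ys, l, l', h⟩ | ⟨d', w', ys, ys', f, h₁, h₂, h₃⟩
      · exact Or.inl ⟨e, _, _, _, Ins.IsDiag.there (p := VDist.ofLoose k) StarOb.pt h⟩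
      · refine Or.inr ⟨d', w', Pts.cons (p := VDist.ofLoose k) StarOb.pt ys,
          Pts.cons (p := VDist.ofLoose k) StarOb.pt ys', f.cons k, ?_, h₂.cons k,
          h₃.cons (p := VDist.ofLoose k) StarOb.pt⟩
        exact congrArg (Step.cons (p := VDist.ofLoose k) StarOb.pt) h₁

/-- Every intermediate object is forced to be the point of a one-object category. The equality is
proved by induction on `s` and is not definitional for a variable `s`, which is why it is supplied
explicitly to later composites. -/
theorem chainTo_path {b c d : V.Obj} (s : V.Path b c) (z : C.Ob c) {w : C.Ob d}
    (ys : Pts (C.chainTo s z) StarOb.pt w) : ys.path = s +++ LPath.one (C.Hom z w) := by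
  induction s with
  | nil c =>
    change Pts (C.corepr z ::: LPath.nil C) StarOb.pt w at ys
    cases ys with
    | cons _ ys =>
      cases ys
      rfl
  | cons k s ih =>
    change Pts (VDist.ofLoose k ::: C.chainTo s z) StarOb.pt w at ys
    cases ys with
    | @cons _ _ _ _ _ _ _ _ _ y _ ys =>
      cases y
      exact congrArg (LPath.cons k) (ih z ys)

/-- At `w = z` this provides the component in which the identity of `z` can be inserted. -/
theorem chainTo_nonempty {b c d : V.Obj} (s : V.Path b c) (z : C.Ob c) (w : C.Ob d) :
    Nonempty (Pts (C.chainTo s z) StarOb.pt w) := by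
  induction s with
  | nil c => exact ⟨Pts.cons (p := C.corepr z) StarOb.pt (Pts.nil w)⟩
  | cons k s ih =>
    obtain ⟨ys⟩ := ih z
    exact ⟨Pts.cons (p := VDist.ofLoose k) StarOb.pt ys⟩

end VCat

section

variable {A C : VCat.{u} V} {b : V.Obj} {p : VDist A (VCat.star.{u} V b)} {c : V.Obj} {q : VDist A C}
  {z : C.Ob c} {s : V.Path b c}

/-- The underlying family of 2-cells of `VTrans.ofNatural`. -/
noncomputable def VTrans.ofNaturalApp
    (θ : ∀ ⦃a : V.Obj⦄ (x : A.Ob a), V.Cell (p.Hom x StarOb.pt ::: s) (q.Hom x z)) :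
    {a d : V.Obj} → {x : A.Ob a} → {w : C.Ob d} → (xs : Pts (p ::: C.chainTo s z) x w) →
      V.Cell xs.path (q.Hom x w)
  | a, _, _, w, Pts.cons (y := StarOb.pt) x ys =>
    V.comp (s := p.Hom x StarOb.pt ::: s) (LPath.nil a) (LPath.one (C.Hom z w)) rfl
      (congrArg (LPath.cons (p.Hom x StarOb.pt)) (VCat.chainTo_path s z ys)) (θ x) (q.actR x z w)

/-- The `V`-natural transformation `p, s₁, …, sₙ, C(z, 1) ⇒ q` determined by a natural family of
2-cells `p(x), s₁, …, sₙ ⇒ q(x, z)`. -/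
noncomputable def VTrans.ofNatural
    (θ : ∀ ⦃a : V.Obj⦄ (x : A.Ob a), V.Cell (p.Hom x StarOb.pt ::: s) (q.Hom x z))
    (hθ : IsNatural p StarOb.pt q z θ) : VTrans (p ::: C.chainTo s z) q where
  app := VTrans.ofNaturalApp θ
  natural := fun {a d x w} i => by
    cases i using Ins.cons_cases with
    -- Position 0: naturality of `θ`, together with the compatibility of the left and right actions
    -- on `q`.
    | @here a' _ x' y ys =>
      cases y
      have hp := VCat.chainTo_path s z ys
      have e₁ := comp_comp (m := p.Hom x StarOb.pt ::: s)
        (m' := A.Hom x x' ::: p.Hom x' StarOb.pt ::: s) (y := p.Hom x StarOb.pt ::: ys.path)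
        (z := A.Hom x x' ::: p.Hom x' StarOb.pt ::: ys.path) (R := ys.path)
        (LPath.nil a) (LPath.one (C.Hom z w)) (LPath.nil a) s rfl hp rfl rfl rfl
        (congrArg (LPath.cons (p.Hom x StarOb.pt)) hp) rfl
        (congrArg (fun t => A.Hom x x' ::: p.Hom x' StarOb.pt ::: t) hp) rfl
        (p.actL x x' StarOb.pt) (θ x) (q.actR x z w)
      have e₂ := congrArg (fun χ => V.comp (s := A.Hom x x' ::: p.Hom x' StarOb.pt ::: s)
        (y := A.Hom x x' ::: p.Hom x' StarOb.pt ::: ys.path)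
        (LPath.nil a) (LPath.one (C.Hom z w)) rfl
        (congrArg (fun t => A.Hom x x' ::: p.Hom x' StarOb.pt ::: t) hp) χ (q.actR x z w)) (hθ x x')
      have e₃ := comp_comp (s := p.Hom x' StarOb.pt ::: s)
        (m' := A.Hom x x' ::: p.Hom x' StarOb.pt ::: s)
        (y := A.Hom x x' ::: q.Hom x' z ::: LPath.one (C.Hom z w))
        (z := A.Hom x x' ::: p.Hom x' StarOb.pt ::: ys.path)
        (LPath.nil a) (LPath.one (C.Hom z w)) (LPath.one (A.Hom x x')) (LPath.nil c)
        rfl rfl rfl (by simp) rfl rfl rfl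
        (congrArg (fun t => A.Hom x x' ::: p.Hom x' StarOb.pt ::: t) hp)
        (congrArg (fun t => A.Hom x x' ::: p.Hom x' StarOb.pt ::: t) hp)
        (θ x') (q.actL x x' z) (q.actR x z w)
      have e₄ := congrArg (V.comp (s := p.Hom x' StarOb.pt ::: s)
        (y := A.Hom x x' ::: p.Hom x' StarOb.pt ::: ys.path)
        (LPath.one (A.Hom x x')) (LPath.one (C.Hom z w)) rfl
        (congrArg (fun t => A.Hom x x' ::: p.Hom x' StarOb.pt ::: t) hp) (θ x'))
        (q.actL_actR x x' z w)
      have e₅ := comp_comp (s := p.Hom x' StarOb.pt ::: s)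
        (y := A.Hom x x' ::: q.Hom x' z ::: LPath.one (C.Hom z w))
        (z := A.Hom x x' ::: p.Hom x' StarOb.pt ::: ys.path) (m' := p.Hom x' StarOb.pt ::: ys.path)
        (LPath.one (A.Hom x x')) (LPath.nil d) (LPath.nil a') (LPath.one (C.Hom z w))
        rfl rfl rfl (congrArg (LPath.cons (p.Hom x' StarOb.pt)) hp) rfl rfl rfl (by simp)
        (congrArg (fun t => A.Hom x x' ::: p.Hom x' StarOb.pt ::: t) hp)
        (θ x') (q.actR x' z w) (q.actL x x' w)
      exact e₅.trans (e₄.symm.trans (e₃.symm.trans (e₂.symm.trans e₁)))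
    | @there _ y i =>
      cases y
      -- At a one-object category naturality is automatic. At the last position it is associativity
      -- of the right action of `C` on `q`.
      rcases VCat.chainTo_cases s z i with ⟨e, ys, l, l', h⟩ | ⟨d', w', ys, ys', f, h₁, h₂, h₃⟩
      · exact (Ins.IsDiag.there x h).eval_eq_of_eta _
      · have hp := VCat.chainTo_path s z ys
        have hp' := VCat.chainTo_path s z ys'
        have hi : i.path = s +++ C.Hom z w' ::: LPath.one (C.Hom w' w) := h₂.source_eq
        have hi' := congrArg (LPath.cons (p.Hom x StarOb.pt)) hi
        have e₁ : (i.toLeft.cons x).eval (VTrans.ofNaturalApp θ) = _ :=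
          congrArg (fun σ => (Step.cons x σ).eval (VTrans.ofNaturalApp θ)) h₁
        have e₂ := (h₂.cons (p.Hom x StarOb.pt)).apply (congrArg (LPath.cons (p.Hom x StarOb.pt)) hp)
          (congrArg (LPath.cons (p.Hom x StarOb.pt)) hi) (VTrans.ofNaturalApp θ (Pts.cons x ys))
        have e₃ := comp_swap (LPath.nil c) (l := LPath.nil a) (r := LPath.nil d)
          (s := p.Hom x StarOb.pt ::: s) (s' := C.Hom z w' ::: LPath.one (C.Hom w' w))
          (x := q.Hom x z ::: LPath.one (C.Hom z w))
          (y := p.Hom x StarOb.pt ::: ys.path) (z := p.Hom x StarOb.pt ::: i.path)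
          (y' := q.Hom x z ::: C.Hom z w' ::: LPath.one (C.Hom w' w))
          (L₁ := LPath.one (q.Hom x z)) (L₂ := p.Hom x StarOb.pt ::: s)
          (R₁ := LPath.one (C.Hom z w)) (R₂ := C.Hom z w' ::: LPath.one (C.Hom w' w))
          rfl (by simp) rfl rfl rfl (congrArg (LPath.cons (p.Hom x StarOb.pt)) hp)
          (congrArg (LPath.cons (p.Hom x StarOb.pt)) hp) hi' rfl rfl rfl hi'
          (θ x) (C.mul z w' w) (q.actR x z w)
        have e₄ := congrArg (V.comp (s := p.Hom x StarOb.pt ::: s)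
          (y := p.Hom x StarOb.pt ::: i.path) (LPath.nil a)
          (C.Hom z w' ::: LPath.one (C.Hom w' w)) rfl hi' (θ x)) (q.actR_mul x z w' w)
        have e₅ := comp_comp (s := p.Hom x StarOb.pt ::: s)
          (y := q.Hom x z ::: C.Hom z w' ::: LPath.one (C.Hom w' w))
          (z := p.Hom x StarOb.pt ::: i.path) (m' := p.Hom x StarOb.pt ::: ys'.path)
          (LPath.nil a) (LPath.one (C.Hom w' w)) (LPath.nil a) (LPath.one (C.Hom z w'))
          rfl rfl rfl (congrArg (LPath.cons (p.Hom x StarOb.pt)) hp') rfl rfl rfl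
          (by simp [hi, hp']) hi' (θ x) (q.actR x z w') (q.actR x w' w)
        have e₆ := (h₃.cons x).eval_eq (VTrans.ofNaturalApp θ)
          (by simp [hi, hp', Pts.path])
        exact e₁.trans (e₂.trans (e₃.trans (e₄.symm.trans (e₅.symm.trans e₆.symm))))

end

end

/-! ### From right lifts to pointwise lifts -/

section

variable {V : VirtualBicategory.{w, v, t}} [V.Normal]

/-- The original family is recovered by the unit law of the right action of `C` on `q`. This is a
Yoneda argument in the variable `z`. -/
theorem VTrans.one_ofNaturalApp {A C : VCat.{u} V} {b : V.Obj} {p : VDist A (VCat.star.{u} V b)}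
    {c : V.Obj} {q : VDist A C} {z : C.Ob c} {s : V.Path b c}
    (θ : ∀ ⦃a : V.Obj⦄ (x : A.Ob a), V.Cell (p.Hom x StarOb.pt ::: s) (q.Hom x z)) {a : V.Obj}
    (x : A.Ob a) (ys : Pts (C.chainTo s z) StarOb.pt z)
    (h : (p.Hom x StarOb.pt ::: ys.path) = (p.Hom x StarOb.pt ::: s) +++ LPath.one (C.Hom z z)) :
    V.comp (y := p.Hom x StarOb.pt ::: s) (p.Hom x StarOb.pt ::: s) (LPath.nil c) h (by simp)
      (C.one z) (VTrans.ofNaturalApp θ (Pts.cons x ys)) = θ x := by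
  refine (comp_swap (LPath.nil c) (l := LPath.nil a) (r := LPath.nil c)
    (s := p.Hom x StarOb.pt ::: s) (s' := LPath.nil c) (x := q.Hom x z ::: LPath.one (C.Hom z z))
    (y := p.Hom x StarOb.pt ::: ys.path) (z := p.Hom x StarOb.pt ::: s)
    (y' := LPath.one (q.Hom x z)) (L₁ := LPath.one (q.Hom x z)) (L₂ := p.Hom x StarOb.pt ::: s)
    (R₁ := LPath.one (C.Hom z z)) (R₂ := LPath.nil c)
    rfl (by simp) rfl rfl rfl h h (by simp) rfl rfl rfl (by simp)
    (θ x) (C.one z) (q.actR x z z)).trans ?_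
  exact (congrArg (V.comp (s := p.Hom x StarOb.pt ::: s) (LPath.nil a) (LPath.nil c) rfl (by simp)
    (θ x)) (q.actR_one x z)).trans (V.comp_id _ _ _)

/-- A right lift of `V`-distributors is computed pointwise. -/
theorem IsRightLift.isLiftAt {A B C : VCat.{u} V} {p : VDist A B} {q : VDist A C}
    {l : VDist B C} {ϖ : VTrans (p ::: LPath.one l) q} (h : IsRightLift ϖ) {b c : V.Obj}
    (y : B.Ob b) (z : C.Ob c) : IsLiftAt p y q z (l.Hom y z)
      (fun _ x => ϖ.app (Pts.cons x (Pts.cons y (Pts.nil z)))) where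
  natural := ϖ.isNatural _
  exists_post {s} θ hθ := by
    obtain ⟨ys⟩ := VCat.chainTo_nonempty s z z
    have hp : ys.path = s +++ LPath.one (C.Hom z z) := VCat.chainTo_path s z ys
    -- `Θ` is a 2-cell `p(1, y), s, C(z, 1) ⇒ q`. Precomposing with the action `p, B(1, y) ⇒ p(1,
    -- y)` gives a source that begins with `p` itself, as the right lift requires.
    let Θ : VTrans (p.restrict (B.point y) ::: C.chainTo s z) q :=
      VTrans.ofNatural (p := p.restrict (B.point y)) θ hθ
    obtain ⟨ψ, hψ, -⟩ := h _ ((p.restrictTrans (B.point y)).precomp Θ)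
    let u : V.Cell (B.Hom y y ::: ys.path) (l.Hom y z) :=
      ψ.app (Pts.cons (p := B.idDist.restrict (B.point y)) y ys)
    have h₀ := congrArg (LPath.cons (B.Hom y y)) hp
    -- The component `u` has source `B(y, y), s, C(z, z)`; the identities of `y` and `z` reduce it
    -- to a 2-cell out of `s`.
    refine ⟨V.comp (LPath.nil b) s rfl rfl (B.one y) (V.comp (y := B.Hom y y ::: s)
      (B.Hom y y ::: s) (LPath.nil c) h₀ (by simp) (C.one z) u), fun a x => ?_⟩
    have h₁ := congrArg (LPath.cons (p.Hom x y)) hp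
    have h₂ := congrArg (LPath.cons (p.Hom x y)) h₀
    have e₁ : post u (ϖ.app (Pts.cons x (Pts.cons y (Pts.nil z))))
      = V.comp (LPath.nil a) ys.path rfl rfl (p.actR x y y) (Θ.app (Pts.cons x ys)) :=
      (hψ x (Pts.cons (p := B.idDist.restrict (B.point y)) y ys)).symm
    refine (post_comp rfl rfl rfl rfl _ _ _).trans ?_
    refine (congrArg (V.comp (LPath.one (p.Hom x y)) s rfl rfl (B.one y))
      ((post_comp _ _ h₂ (by simp) _ _ _).trans (congrArg _ e₁))).trans ?_
    have e₂ := comp_swap s (l := LPath.nil a) (r := LPath.nil c)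
      (s := p.Hom x y ::: LPath.one (B.Hom y y)) (s' := LPath.nil c)
      (x := p.Hom x y ::: ys.path)
      (y := p.Hom x y ::: B.Hom y y ::: ys.path) (z := p.Hom x y ::: B.Hom y y ::: s)
      (y' := p.Hom x y ::: s) (L₁ := p.Hom x y ::: s) (L₂ := p.Hom x y ::: B.Hom y y ::: s)
      (R₁ := ys.path) (R₂ := s)
      rfl rfl hp (by simp) rfl rfl h₂ (by simp) h₁ (by simp) rfl rfl
      (p.actR x y y) (C.one z) (Θ.app (Pts.cons x ys))
    have e₃ := congrArg (V.comp (y := p.Hom x y ::: B.Hom y y ::: s) (LPath.nil a) s rfl rfl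
      (p.actR x y y)) (VTrans.one_ofNaturalApp (p := p.restrict (B.point y)) θ x ys h₁)
    have e₄ := comp_comp (y := p.Hom x y ::: B.Hom y y ::: s) (z := p.Hom x y ::: s)
      (LPath.nil a) s (LPath.one (p.Hom x y)) (LPath.nil b) rfl rfl rfl rfl rfl rfl rfl rfl rfl
      (B.one y) (p.actR x y y) (θ x)
    have e₅ := congrArg (fun χ => V.comp (y := p.Hom x y ::: s) (LPath.nil a) s rfl rfl χ (θ x))
      (p.actR_one x y)
    refine (congrArg (V.comp (y := p.Hom x y ::: s) (LPath.one (p.Hom x y)) s rfl rfl (B.one y))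
      (e₂.trans e₃)).trans (e₄.symm.trans (e₅.trans ?_))
    exact V.id_comp _ _ _ _ _
  ext {s} χ χ' hχ := by
    obtain ⟨ys⟩ := VCat.chainTo_nonempty s z z
    have hp : ys.path = s +++ LPath.one (C.Hom z z) := VCat.chainTo_path s z ys
    have h₀ := congrArg (LPath.cons (B.Hom y y)) hp
    -- A 2-cell `ξ : s ⇒ l(y, z)` is spread to a 2-cell `B(1, y), s, C(z, 1) ⇒ l` by the two actions
    -- on `l`, so that uniqueness for the right lift can be applied to it.
    let θ : V.Cell s (l.Hom y z) → ∀ ⦃b' : V.Obj⦄ (y' : B.Ob b'),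
        V.Cell ((B.idDist.restrict (B.point y)).Hom y' StarOb.pt ::: s) (l.Hom y' z) :=
      fun ξ _ y' => post ξ (l.actL y' y z)
    have hθ : ∀ ξ, IsNatural (B.idDist.restrict (B.point y)) StarOb.pt l z (θ ξ) := fun ξ =>
      IsNatural.post (p := B.idDist) (fun _ _ x x' => l.mul_actL x x' y z) ξ
    let X : V.Cell s (l.Hom y z) → VTrans (B.idDist.restrict (B.point y) ::: C.chainTo s z) l :=
      fun ξ => VTrans.ofNatural (θ ξ) (hθ ξ)
    -- The composite of `X ξ` with `ϖ` depends on `ξ` only through `post ξ (ϖ x)`, because both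
    -- actions on `l` can be moved across `ϖ`.
    have key : ∀ ξ {a b' c' : V.Obj} (x : A.Ob a) (y' : B.Ob b') (z' : C.Ob c')
        (zs : Pts (C.chainTo s z) StarOb.pt z')
        (hs : zs.path = s +++ LPath.one (C.Hom z z')),
        post ((X ξ).app (Pts.cons y' zs)) (ϖ.app (Pts.cons x (Pts.cons y' (Pts.nil z'))))
          = V.comp (s := p.Hom x y' ::: B.Hom y' y ::: s) (LPath.nil a) (LPath.one (C.Hom z z')) rfl
            (congrArg (fun t => p.Hom x y' ::: B.Hom y' y ::: t) hs)
            (V.comp (LPath.nil a) s rfl rfl (p.actR x y' y)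
              (post ξ (ϖ.app (Pts.cons x (Pts.cons y (Pts.nil z)))))) (q.actR x z z') := by
      intro ξ a b' c' x y' z' zs hs
      refine (ϖ.post_actR x y' z z' (congrArg (LPath.cons (B.Hom y' y)) hs)
        (post ξ (l.actL y' y z))).trans ?_
      exact congrArg (fun ζ => V.comp (s := p.Hom x y' ::: B.Hom y' y ::: s) (LPath.nil a)
        (LPath.one (C.Hom z z')) rfl (congrArg (fun t => p.Hom x y' ::: B.Hom y' y ::: t) hs) ζ
        (q.actR x z z')) (ϖ.post_actL x y' y z ξ)
    have hX : X χ = X χ' := by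
      refine (h _ (ϖ.postcomp (X χ))).unique ?_ ?_
      · intro a b' c' x y' z' zs
        rfl
      · intro a b' c' x y' z' zs
        cases zs with
        | @cons _ _ _ _ _ _ _ _ _ i _ zs =>
          cases i
          have hs := VCat.chainTo_path s z zs
          refine (key χ x y' z' zs hs).trans (Eq.trans ?_ (key χ' x y' z' zs hs).symm)
          rw [hχ]
    -- Inserting the identities of `y` and `z` recovers `ξ` from `X ξ`, so `X` is injective.
    have e : ∀ ξ, V.comp (LPath.nil b) s rfl rfl (B.one y) (V.comp (y := B.Hom y y ::: s)
        (B.Hom y y ::: s) (LPath.nil c) h₀ (by simp) (C.one z)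
        ((X ξ).app (Pts.cons y ys))) = ξ := fun ξ =>
      (congrArg (V.comp (LPath.nil b) s rfl rfl (B.one y))
        (VTrans.one_ofNaturalApp (θ ξ) y ys h₀)).trans (comp_post_of_unit (l.one_actL y z) ξ)
    rw [← e χ, hX, e χ']

end

/-! ### Right lifts of presheaves -/

section

variable {V : VirtualBicategory.{w, v, t}}

/-- A family of 2-cells `p(x, y), l(y, z) ⇒ q(x, z)`, as a family indexed by `Pts`. -/
def Pts.family₂ {A B C : VCat.{u} V} {p : VDist A B} {l : VDist B C} {q : VDist A C}
    (φ : ∀ {a b c : V.Obj} (x : A.Ob a) (y : B.Ob b) (z : C.Ob c),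
      V.Cell (p.Hom x y ::: LPath.one (l.Hom y z)) (q.Hom x z)) :
    {a c : V.Obj} → {x : A.Ob a} → {z : C.Ob c} → (xs : Pts (p ::: LPath.one l) x z) →
      V.Cell xs.path (q.Hom x z)
  | _, _, _, _, Pts.cons x (Pts.cons y (Pts.nil z)) => φ x y z

/-- A chain of length two has exactly three positions; the hypotheses treat a hom-morphism of `A`,
of `B` and of `C` respectively. -/
theorem Pts.family₂_natural {A B C : VCat.{u} V} {p : VDist A B} {l : VDist B C} {q : VDist A C}
    (φ : ∀ {a b c : V.Obj} (x : A.Ob a) (y : B.Ob b) (z : C.Ob c),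
      V.Cell (p.Hom x y ::: LPath.one (l.Hom y z)) (q.Hom x z))
    (h₀ : ∀ {a a' b c : V.Obj} (x : A.Ob a) (x' : A.Ob a') (y : B.Ob b) (z : C.Ob c),
      (Ins.here x (Pts.cons x' (Pts.cons (p := l) y (Pts.nil z)))).toLeft.eval (family₂ (p := p) φ)
        = (Ins.here x (Pts.cons x' (Pts.cons y (Pts.nil z)))).toRight.eval (family₂ φ))
    (h₁ : ∀ {a b b' c : V.Obj} (x : A.Ob a) (y : B.Ob b) (y' : B.Ob b') (z : C.Ob c),
      (Ins.there x (Ins.here y (Pts.cons (p := l) y' (Pts.nil z)))).toLeft.eval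
          (family₂ (p := p) φ)
        = (Ins.there x (Ins.here y (Pts.cons y' (Pts.nil z)))).toRight.eval (family₂ φ))
    (h₂ : ∀ {a b c c' : V.Obj} (x : A.Ob a) (y : B.Ob b) (z : C.Ob c) (z' : C.Ob c'),
      (Ins.there x (Ins.there (p := l) y (Ins.here z (Pts.nil z')))).toLeft.eval
          (family₂ (p := p) φ)
        = (Ins.there x (Ins.there y (Ins.here z (Pts.nil z')))).toRight.eval (family₂ φ))
    {a c : V.Obj} {x : A.Ob a} {z : C.Ob c} (i : Ins (p ::: LPath.one l) x z) :
    i.toLeft.eval (family₂ φ) = i.toRight.eval (family₂ φ) := by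
  match i with
  | Ins.here x (Pts.cons x' (Pts.cons y (Pts.nil z))) => exact h₀ x x' y z
  | Ins.there x (Ins.here y (Pts.cons y' (Pts.nil z))) => exact h₁ x y y' z
  | Ins.there x (Ins.there y (Ins.here z (Pts.nil z'))) => exact h₂ x y z z'

variable [V.Normal]

/-- The family of 2-cells `p(x), k ⇒ q(x)`, indexed by the objects of the one-object
`V`-categories. -/
noncomputable def starFamily {A : VCat.{u} V} {e e' : V.Obj} {p : Presheaf A e}
    {q : Presheaf A e'} {k : V.Loose e e'}
    (ϖ : ∀ ⦃a : V.Obj⦄ (x : A.Ob a), V.Cell (p.Hom x StarOb.pt ::: LPath.one k) (q.Hom x StarOb.pt))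
    {a b c : V.Obj} (x : A.Ob a) (y : (VCat.star.{u} V e).Ob b) (z : (VCat.star.{u} V e').Ob c) :
    V.Cell (p.Hom x y ::: LPath.one ((VDist.ofLoose.{u} k).Hom y z)) (q.Hom x z) :=
  match y, z with
  | StarOb.pt, StarOb.pt => ϖ x

/-- The `V`-natural transformation `p, k ⇒ q` determined by a natural family of 2-cells
`p(x), k ⇒ q(x)`. -/
noncomputable def VTrans.ofFamily {A : VCat.{u} V} {e e' : V.Obj} {p : Presheaf A e}
    {q : Presheaf A e'} {k : V.Loose e e'}
    (ϖ : ∀ ⦃a : V.Obj⦄ (x : A.Ob a), V.Cell (p.Hom x StarOb.pt ::: LPath.one k) (q.Hom x StarOb.pt))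
    (h : IsNatural p StarOb.pt q StarOb.pt ϖ) :
    VTrans (p ::: LPath.one (VDist.ofLoose.{u} k)) q where
  app := Pts.family₂ (starFamily ϖ)
  natural := Pts.family₂_natural (starFamily ϖ)
    (fun x x' y z => by
      cases y
      cases z
      exact (h x x').symm)
    -- At the two one-object categories the inserted hom-morphism is a loose-identity, so
    -- opcartesianness of `η` gives naturality.
    (fun x y y' z => by
      cases y
      cases y'
      exact (Ins.IsDiag.there x
        (Ins.IsDiag.here (C := VCat.star V e) (x := StarOb.pt) _)).eval_eq_of_eta _)
    (fun x y z z' => by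
      cases z
      cases z'
      exact (Ins.IsDiag.there x (Ins.IsDiag.there y
        (Ins.IsDiag.here (C := VCat.star V e') (x := StarOb.pt) _))).eval_eq_of_eta _)

/-- The right lift of presheaves exists if and only if there is a universal loose-cell. -/
theorem hasRightLift_iff {A : VCat.{u} V} {e e' : V.Obj} (p : Presheaf A e) (q : Presheaf A e') :
    HasRightLift q p ↔ ∃ k ϖ, IsLiftAt p StarOb.pt q StarOb.pt k ϖ := by
  constructor
  · rintro ⟨l, ϖ, h⟩
    exact ⟨_, _, h.isLiftAt StarOb.pt StarOb.pt⟩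
  · rintro ⟨k, ϖ, h⟩
    refine ⟨VDist.ofLoose k, VTrans.ofFamily ϖ h.natural, isRightLift_of_isLiftAt _ ?_⟩
    intro b c y z
    cases y
    cases z
    exact ⟨h.natural, h.exists_post, h.ext⟩

/-- The action of `⋆ₑ` on a presheaf is determined by the other data. -/
theorem Presheaf.ext {A : VCat.{u} V} {e : V.Obj} {p q : Presheaf A e}
    (hHom : ∀ {a : V.Obj} (x : A.Ob a), p.Hom x StarOb.pt = q.Hom x StarOb.pt)
    (hact : ∀ {a a' : V.Obj} (x : A.Ob a) (x' : A.Ob a'),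
      HEq (p.actL x x' StarOb.pt) (q.actL x x' StarOb.pt)) : p = q := by
  obtain ⟨Hom, actL, actR, _, _, hp, _, _⟩ := p
  obtain ⟨Hom', actL', actR', _, _, hq, _, _⟩ := q
  have h₁ : @Hom = @Hom' := by
    funext a b x y
    cases y
    exact hHom x
  subst h₁
  have h₂ : @actL = @actL' := by
    funext a a' b x x' y
    cases y
    exact eq_of_heq (hact x x')
  subst h₂
  have h₃ : @actR = @actR' := by
    funext a b b' x y y'
    cases y
    cases y'
    -- The unit law prescribes the right action after insertion of `η`, and opcartesianness makes
    -- that determine it.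
    exact Normal.ext (LPath.one (Hom x StarOb.pt)) (LPath.nil e)
      ((hp x StarOb.pt).trans (hq x StarOb.pt).symm)
  subst h₃
  rfl

end

/-! ### Presheaf categories -/

section

variable {V : VirtualBicategory.{w, v, t}}

theorem IsNatural.id {A B : VCat.{u} V} (p : VDist A B) {b : V.Obj} (y : B.Ob b) :
    IsNatural p y p y (s := LPath.nil b) (fun _ x => V.id (p.Hom x y)) :=
  fun _ _ _ _ => (V.comp_id _ _ _).trans (V.id_comp _ _ _ _ _).symm

/-- The left action of `A` is passed through `θ'` and then through `θ`. Applied to two evaluations,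
this yields the composition of the category of presheaves. -/
theorem IsNatural.comp {A B C D : VCat.{u} V} {p : VDist A B} {q : VDist A C} {r : VDist A D}
    {b c d : V.Obj} {y : B.Ob b} {z : C.Ob c} {w : D.Ob d} {s : V.Path b c} {s' : V.Path c d}
    {θ : ∀ ⦃a : V.Obj⦄ (x : A.Ob a), V.Cell (p.Hom x y ::: s) (q.Hom x z)}
    {θ' : ∀ ⦃a : V.Obj⦄ (x : A.Ob a), V.Cell (q.Hom x z ::: s') (r.Hom x w)}
    (h : IsNatural p y q z θ) (h' : IsNatural q z r w θ') :
    IsNatural p y r w (fun a x =>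
      V.comp (y := p.Hom x y ::: (s +++ s')) (LPath.nil a) s' rfl rfl (θ x) (θ' x)) := by
  intro a a' x x'
  have e₁ := comp_comp (y := p.Hom x y ::: (s +++ s'))
    (z := A.Hom x x' ::: p.Hom x' y ::: (s +++ s')) (LPath.nil a) s' (LPath.nil a) s
    rfl rfl rfl rfl rfl rfl rfl rfl rfl (p.actL x x' y) (θ x) (θ' x)
  have e₂ := congrArg (fun χ => V.comp (y := A.Hom x x' ::: p.Hom x' y ::: (s +++ s'))
    (LPath.nil a) s' rfl rfl χ (θ' x)) (h x x')
  have e₃ := comp_comp (m' := A.Hom x x' ::: p.Hom x' y ::: s) (y := A.Hom x x' ::: q.Hom x' z ::: s')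
    (z := A.Hom x x' ::: p.Hom x' y ::: (s +++ s')) (LPath.nil a) s' (LPath.one (A.Hom x x'))
    (LPath.nil c) rfl rfl rfl (by simp) rfl rfl rfl rfl rfl (θ x') (q.actL x x' z) (θ' x)
  have e₄ := congrArg (V.comp (y := A.Hom x x' ::: p.Hom x' y ::: (s +++ s'))
    (LPath.one (A.Hom x x')) s' rfl rfl (θ x')) (h' x x')
  have e₅ := comp_comp (m' := p.Hom x' y ::: (s +++ s')) (y := A.Hom x x' ::: q.Hom x' z ::: s')
    (z := A.Hom x x' ::: p.Hom x' y ::: (s +++ s')) (LPath.one (A.Hom x x')) (LPath.nil d)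
    (LPath.nil a') s' rfl (by simp) rfl rfl rfl (by simp) rfl (by simp) rfl
    (θ x') (θ' x') (r.actL x x' w)
  exact e₁.symm.trans (e₂.trans (e₃.trans (e₄.trans e₅.symm)))

namespace IsLiftAt

variable {A B C : VCat.{u} V} {p : VDist A B} {b : V.Obj} {y : B.Ob b} {q : VDist A C}
  {c : V.Obj} {z : C.Ob c} {k : V.Loose b c}
  {ϖ : ∀ ⦃a : V.Obj⦄ (x : A.Ob a), V.Cell (p.Hom x y ::: LPath.one k) (q.Hom x z)}

/-- The 2-cell `s ⇒ k` that corresponds to a natural family `p(x, y), s ⇒ q(x, z)`. -/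
noncomputable def desc (h : IsLiftAt p y q z k ϖ) {s : V.Path b c}
    (θ : ∀ ⦃a : V.Obj⦄ (x : A.Ob a), V.Cell (p.Hom x y ::: s) (q.Hom x z))
    (hθ : IsNatural p y q z θ) : V.Cell s k :=
  (h.exists_post θ hθ).choose

theorem post_desc (h : IsLiftAt p y q z k ϖ) {s : V.Path b c}
    (θ : ∀ ⦃a : V.Obj⦄ (x : A.Ob a), V.Cell (p.Hom x y ::: s) (q.Hom x z))
    (hθ : IsNatural p y q z θ) {a : V.Obj} (x : A.Ob a) : post (h.desc θ hθ) (ϖ x) = θ x :=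
  (h.exists_post θ hθ).choose_spec x

end IsLiftAt

/-- If `π` is pointwise dense, an action of `X` on the loose-cells `π(a, f x)` makes `f` a
`V`-functor. -/
noncomputable def VFunctor.ofAction {A Q X : VCat.{u} V} {π : VDist A Q}
    (hπ : ∀ {b c : V.Obj} (y : Q.Ob b) (z : Q.Ob c),
      IsLiftAt π y π z (Q.Hom y z) (fun _ x => π.actR x y z))
    (obj : ∀ {b : V.Obj}, X.Ob b → Q.Ob b)
    (act : ∀ {a b b' : V.Obj} (x : A.Ob a) (y : X.Ob b) (y' : X.Ob b'),
      V.Cell (π.Hom x (obj y) ::: LPath.one (X.Hom y y')) (π.Hom x (obj y')))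
    (act_one : ∀ {a b : V.Obj} (x : A.Ob a) (y : X.Ob b),
      V.comp (LPath.one (π.Hom x (obj y))) (LPath.nil b) rfl rfl (X.one y) (act x y y)
        = V.id (π.Hom x (obj y)))
    (act_mul : ∀ {a b b' b'' : V.Obj} (x : A.Ob a) (y : X.Ob b) (y' : X.Ob b') (y'' : X.Ob b''),
      V.comp (y := π.Hom x (obj y) ::: X.Hom y y' ::: LPath.one (X.Hom y' y''))
          (LPath.nil a) (LPath.one (X.Hom y' y'')) rfl rfl (act x y y') (act x y' y'')
        = V.comp (LPath.one (π.Hom x (obj y))) (LPath.nil b'') rfl rfl (X.mul y y' y'')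
          (act x y y''))
    (actL_act : ∀ {b b' : V.Obj} (y : X.Ob b) (y' : X.Ob b'),
      IsNatural π (obj y) π (obj y') (fun _ x => act x y y')) : VFunctor X Q where
  obj := obj
  map y y' := (hπ (obj y) (obj y')).desc _ (actL_act y y')
  map_one {b} y := by
    -- The functor laws compare 2-cells into hom-morphisms of `Q`, which are pointwise lifts, so
    -- they may be checked on `π`. There they are the unit and associativity laws of `act`.
    refine (hπ (obj y) (obj y)).ext _ _ fun a x => ?_
    refine (post_comp rfl rfl rfl rfl _ _ _).trans ?_
    refine (congrArg (V.comp (LPath.one (π.Hom x (obj y))) (LPath.nil b) rfl rfl (X.one y))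
      ((hπ (obj y) (obj y)).post_desc _ (actL_act y y) x)).trans ?_
    exact (act_one x y).trans (π.actR_one x (obj y)).symm
  map_mul {b b' b''} y y' y'' := by
    refine (hπ (obj y) (obj y'')).ext _ _ fun a x => ?_
    have m₁ := (hπ (obj y) (obj y')).post_desc _ (actL_act y y') x
    have m₂ := (hπ (obj y') (obj y'')).post_desc _ (actL_act y' y'') x
    have m₃ := (hπ (obj y) (obj y'')).post_desc _ (actL_act y y'') x
    -- From here on only the evaluations `m₁`, `m₂`, `m₃` of the three values of `map` are used.
    generalize (hπ (obj y) (obj y')).desc _ (actL_act y y') = f₁ at m₁ ⊢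
    generalize (hπ (obj y') (obj y'')).desc _ (actL_act y' y'') = f₂ at m₂ ⊢
    generalize (hπ (obj y) (obj y'')).desc _ (actL_act y y'') = f₃ at m₃ ⊢
    refine (post_comp rfl rfl rfl rfl _ _ _).trans ?_
    refine (congrArg (V.comp (y := π.Hom x (obj y) ::: X.Hom y y' ::: LPath.one (X.Hom y' y''))
      (LPath.one (π.Hom x (obj y))) (LPath.nil b'') rfl rfl (X.mul y y' y'')) m₃).trans ?_
    refine (act_mul x y y' y'').symm.trans ?_
    refine Eq.trans ?_ (post_comp (l := LPath.nil b) (r := LPath.one (X.Hom y' y''))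
      (x := Q.Hom (obj y) (obj y') ::: LPath.one (X.Hom y' y''))
      (y := X.Hom y y' ::: LPath.one (X.Hom y' y'')) rfl rfl rfl rfl f₁
      (V.comp (LPath.one (Q.Hom (obj y) (obj y'))) (LPath.nil b'') rfl rfl f₂
        (Q.mul (obj y) (obj y') (obj y''))) (π.actR x (obj y) (obj y''))).symm
    have e₁ := post_comp (l := LPath.one (Q.Hom (obj y) (obj y'))) (r := LPath.nil b'')
      (x := Q.Hom (obj y) (obj y') ::: LPath.one (Q.Hom (obj y') (obj y'')))
      (y := Q.Hom (obj y) (obj y') ::: LPath.one (X.Hom y' y'')) rfl rfl rfl rfl f₂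
      (Q.mul (obj y) (obj y') (obj y'')) (π.actR x (obj y) (obj y''))
    have e₂ := congrArg (V.comp (y := π.Hom x (obj y) ::: Q.Hom (obj y) (obj y') :::
      LPath.one (X.Hom y' y'')) (π.Hom x (obj y) ::: LPath.one (Q.Hom (obj y) (obj y')))
      (LPath.nil b'') rfl rfl f₂) (π.actR_mul x (obj y) (obj y') (obj y''))
    have e₃ := comp_post (x := π.Hom x (obj y) ::: Q.Hom (obj y) (obj y') :::
      LPath.one (X.Hom y' y'')) (y := π.Hom x (obj y) ::: Q.Hom (obj y) (obj y') :::
      LPath.one (Q.Hom (obj y') (obj y''))) rfl rfl rfl rfl rfl rfl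
      (π.actR x (obj y) (obj y')) f₂ (π.actR x (obj y') (obj y''))
    have e₄ := congrArg (V.comp (y := π.Hom x (obj y) ::: Q.Hom (obj y) (obj y') :::
      LPath.one (X.Hom y' y'')) (LPath.nil a) (LPath.one (X.Hom y' y'')) rfl rfl
      (π.actR x (obj y) (obj y'))) m₂
    refine Eq.trans ?_ (congrArg (V.comp (y := π.Hom x (obj y) ::: X.Hom y y' :::
      LPath.one (X.Hom y' y'')) (LPath.one (π.Hom x (obj y))) (LPath.one (X.Hom y' y'')) rfl rfl f₁)
      (e₁.trans (e₂.symm.trans (e₃.symm.trans e₄)))).symm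
    refine Eq.trans ?_ (post_right (y := π.Hom x (obj y) ::: Q.Hom (obj y) (obj y') :::
      LPath.one (X.Hom y' y'')) (x := π.Hom x (obj y) ::: X.Hom y y' ::: LPath.one (X.Hom y' y''))
      rfl rfl rfl rfl rfl rfl f₁ (π.actR x (obj y) (obj y')) (act x y' y''))
    exact congrArg (fun χ => V.comp (y := π.Hom x (obj y) ::: X.Hom y y' :::
      LPath.one (X.Hom y' y'')) (LPath.nil a) (LPath.one (X.Hom y' y'')) rfl rfl χ (act x y' y''))
      m₁.symm

end

/-! ### The category of presheaves and its universal distributor -/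

section

variable {V : VirtualBicategory.{w, v, t}}

/-- A family of presheaves on `A`, with a universal loose-cell for any two of its members. -/
structure LiftFamily (A : VCat.{u} V) [V.Normal] where
  Ix : V.Obj → Type u
  psh : {e : V.Obj} → Ix e → Presheaf A e
  hom : {e e' : V.Obj} → Ix e → Ix e' → V.Loose e e'
  ev : {e e' : V.Obj} → (i : Ix e) → (j : Ix e') → ⦃a : V.Obj⦄ → (x : A.Ob a) →
    V.Cell ((psh i).Hom x StarOb.pt ::: LPath.one (hom i j)) ((psh j).Hom x StarOb.pt)
  isLiftAt : ∀ {e e' : V.Obj} (i : Ix e) (j : Ix e'),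
    IsLiftAt (psh i) StarOb.pt (psh j) StarOb.pt (hom i j) (ev i j)

namespace LiftFamily

variable [V.Normal] {A : VCat.{u} V} (F : LiftFamily A)

/-- The identity of an object of the `V`-category of presheaves. -/
noncomputable def one {e : V.Obj} (i : F.Ix e) : V.Cell (LPath.nil e) (F.hom i i) :=
  (F.isLiftAt i i).desc _ (IsNatural.id (F.psh i) StarOb.pt)

theorem post_one {e : V.Obj} (i : F.Ix e) {a : V.Obj} (x : A.Ob a) :
    post (F.one i) (F.ev i i x) = V.id ((F.psh i).Hom x StarOb.pt) :=
  (F.isLiftAt i i).post_desc _ _ x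

/-- The composition of the `V`-category of presheaves. -/
noncomputable def mul {e e' e'' : V.Obj} (i : F.Ix e) (j : F.Ix e') (k : F.Ix e'') :
    V.Cell (F.hom i j ::: LPath.one (F.hom j k)) (F.hom i k) :=
  (F.isLiftAt i k).desc _ ((F.isLiftAt i j).natural.comp (F.isLiftAt j k).natural)

theorem post_mul {e e' e'' : V.Obj} (i : F.Ix e) (j : F.Ix e') (k : F.Ix e'') {a : V.Obj}
    (x : A.Ob a) : post (F.mul i j k) (F.ev i k x)
      = V.comp (y := (F.psh i).Hom x StarOb.pt ::: F.hom i j ::: LPath.one (F.hom j k))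
          (LPath.nil a) (LPath.one (F.hom j k)) rfl rfl (F.ev i j x) (F.ev j k x) :=
  (F.isLiftAt i k).post_desc _ _ x

/-- The `V`-category of presheaves. -/
noncomputable def cat : VCat.{u} V where
  Ob := F.Ix
  Hom i j := F.hom i j
  one i := F.one i
  mul i j k := F.mul i j k
  one_mul {e e'} i j := by
    -- The category laws hold because both sides have the same evaluation on the presheaf `F.psh i`.
    refine (F.isLiftAt i j).ext _ _ fun a x => ?_
    have e₁ := post_comp (l := LPath.nil e) (r := LPath.one (F.hom i j))
      (x := F.hom i i ::: LPath.one (F.hom i j)) (y := LPath.one (F.hom i j)) rfl rfl rfl rfl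
      (F.one i) (F.mul i i j) (F.ev i j x)
    have e₂ := congrArg (V.comp (y := (F.psh i).Hom x StarOb.pt ::: LPath.one (F.hom i j))
      (LPath.one ((F.psh i).Hom x StarOb.pt)) (LPath.one (F.hom i j)) rfl rfl (F.one i))
      (F.post_mul i i j x)
    have e₃ := post_right (x := (F.psh i).Hom x StarOb.pt ::: LPath.one (F.hom i j))
      (y := (F.psh i).Hom x StarOb.pt ::: F.hom i i ::: LPath.one (F.hom i j))
      rfl rfl rfl rfl rfl rfl (F.one i) (F.ev i i x) (F.ev i j x)
    have e₄ := congrArg (fun χ => V.comp (y := (F.psh i).Hom x StarOb.pt ::: LPath.one (F.hom i j))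
      (LPath.nil a) (LPath.one (F.hom i j)) rfl rfl χ (F.ev i j x)) (F.post_one i x)
    exact e₁.trans (e₂.trans (e₃.symm.trans (e₄.trans ((V.id_comp _ _ _ _ _).trans
      (post_id _).symm))))
  mul_one {e e'} i j := by
    refine (F.isLiftAt i j).ext _ _ fun a x => ?_
    have e₁ := post_comp (l := LPath.one (F.hom i j)) (r := LPath.nil e')
      (x := F.hom i j ::: LPath.one (F.hom j j)) (y := LPath.one (F.hom i j)) rfl rfl rfl rfl
      (F.one j) (F.mul i j j) (F.ev i j x)
    have e₂ := congrArg (V.comp (y := (F.psh i).Hom x StarOb.pt ::: LPath.one (F.hom i j))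
      ((F.psh i).Hom x StarOb.pt ::: LPath.one (F.hom i j)) (LPath.nil e') rfl rfl (F.one j))
      (F.post_mul i j j x)
    have e₃ := comp_post (x := (F.psh i).Hom x StarOb.pt ::: LPath.one (F.hom i j))
      (y := (F.psh i).Hom x StarOb.pt ::: F.hom i j ::: LPath.one (F.hom j j))
      rfl rfl rfl rfl rfl rfl (F.ev i j x) (F.one j) (F.ev j j x)
    have e₄ := congrArg (V.comp (y := (F.psh i).Hom x StarOb.pt ::: LPath.one (F.hom i j))
      (LPath.nil a) (LPath.nil e') rfl rfl (F.ev i j x)) (F.post_one j x)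
    exact e₁.trans (e₂.trans (e₃.symm.trans (e₄.trans ((V.comp_id _ _ _).trans
      (post_id _).symm))))
  assoc {e₀ e₁ e₂ e₃} i j k m := by
    -- Both sides evaluate to the successive evaluations `F.ev i j`, `F.ev j k`, `F.ev k m`.
    refine (F.isLiftAt i m).ext _ _ fun a x => ?_
    let p := (F.psh i).Hom x StarOb.pt
    have h₁ := post_comp (l := LPath.nil e₀) (r := LPath.one (F.hom k m))
      (x := F.hom i k ::: LPath.one (F.hom k m))
      (y := F.hom i j ::: F.hom j k ::: LPath.one (F.hom k m)) rfl rfl rfl rfl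
      (F.mul i j k) (F.mul i k m) (F.ev i m x)
    have h₂ := congrArg (V.comp (y := p ::: F.hom i j ::: F.hom j k ::: LPath.one (F.hom k m))
      (LPath.one p) (LPath.one (F.hom k m)) rfl rfl (F.mul i j k)) (F.post_mul i k m x)
    have h₃ := post_right (x := p ::: F.hom i j ::: F.hom j k ::: LPath.one (F.hom k m))
      (y := p ::: F.hom i k ::: LPath.one (F.hom k m))
      rfl rfl rfl rfl rfl rfl (F.mul i j k) (F.ev i k x) (F.ev k m x)
    have h₄ := congrArg (fun χ => V.comp
      (y := p ::: F.hom i j ::: F.hom j k ::: LPath.one (F.hom k m))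
      (LPath.nil a) (LPath.one (F.hom k m)) rfl rfl χ (F.ev k m x)) (F.post_mul i j k x)
    have h₅ := comp_comp (y := (F.psh j).Hom x StarOb.pt ::: F.hom j k ::: LPath.one (F.hom k m))
      (z := p ::: F.hom i j ::: F.hom j k ::: LPath.one (F.hom k m))
      (LPath.nil a) (LPath.one (F.hom k m)) (LPath.nil a) (LPath.one (F.hom j k))
      rfl rfl rfl rfl rfl rfl rfl rfl rfl (F.ev i j x) (F.ev j k x) (F.ev k m x)
    have h₆ := congrArg (V.comp (y := p ::: F.hom i j ::: F.hom j k ::: LPath.one (F.hom k m))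
      (LPath.nil a) (F.hom j k ::: LPath.one (F.hom k m)) rfl rfl (F.ev i j x))
      (F.post_mul j k m x)
    have h₇ := comp_post (x := p ::: F.hom i j ::: F.hom j k ::: LPath.one (F.hom k m))
      (y := p ::: F.hom i j ::: LPath.one (F.hom j m))
      rfl rfl rfl rfl rfl rfl (F.ev i j x) (F.mul j k m) (F.ev j m x)
    have h₈ := congrArg (V.comp (y := p ::: F.hom i j ::: F.hom j k ::: LPath.one (F.hom k m))
      (p ::: LPath.one (F.hom i j)) (LPath.nil e₃) rfl rfl (F.mul j k m)) (F.post_mul i j m x)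
    have h₉ := post_comp (l := LPath.one (F.hom i j)) (r := LPath.nil e₃)
      (x := F.hom i j ::: LPath.one (F.hom j m))
      (y := F.hom i j ::: F.hom j k ::: LPath.one (F.hom k m)) rfl rfl rfl rfl
      (F.mul j k m) (F.mul i j m) (F.ev i m x)
    exact h₁.trans (h₂.trans (h₃.symm.trans (h₄.trans (h₅.trans (h₆.symm.trans (h₇.trans
      (h₈.symm.trans h₉.symm)))))))

/-- The universal `V`-distributor, given by evaluation of presheaves. -/
noncomputable def dist : VDist A F.cat where
  Hom x i := (F.psh i).Hom x StarOb.pt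
  actL x x' i := (F.psh i).actL x x' StarOb.pt
  actR x i j := F.ev i j x
  one_actL x i := (F.psh i).one_actL x StarOb.pt
  mul_actL x x' x'' i := (F.psh i).mul_actL x x' x'' StarOb.pt
  -- The laws of the right action are the equations that define the identities and composition of
  -- `F.cat`; compatibility of the two actions is naturality of evaluation.
  actR_one x i := F.post_one i x
  actR_mul x i j k := (F.post_mul i j k x).symm
  actL_actR x x' i j := (F.isLiftAt i j).natural x x'

theorem dist_isLiftAt {e e' : V.Obj} (i : F.cat.Ob e) (j : F.cat.Ob e') :
    IsLiftAt F.dist i F.dist j (F.cat.Hom i j) (fun _ x => F.dist.actR x i j) :=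
  ⟨(F.isLiftAt i j).natural, (F.isLiftAt i j).exists_post, (F.isLiftAt i j).ext⟩

theorem dist_dense : F.dist.Dense :=
  isRightLift_of_isLiftAt _ F.dist_isLiftAt

/-- Hom-morphisms and left actions agree definitionally, and the remaining action has no freedom by
`Presheaf.ext`. The result is a strict equality, as strict classification by functors demands. -/
theorem presheafAt_dist_restrict {X : VCat.{u} V} (f : VFunctor X F.cat) {e : V.Obj} (x : X.Ob e) :
    (F.dist.restrict f).presheafAt x = F.psh (f.obj x) :=
  Presheaf.ext (fun _ => rfl) (fun _ _ => HEq.rfl)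

/-- A `V`-functor to the `V`-category of presheaves is determined by its restriction of the
universal `V`-distributor. -/
theorem functor_ext (hF : ∀ {e : V.Obj}, Function.Injective (F.psh (e := e))) {X : VCat.{u} V}
    {f g : VFunctor X F.cat} (h : F.dist.restrict f = F.dist.restrict g) : f = g := by
  have hobj : @VFunctor.obj _ _ _ f = @VFunctor.obj _ _ _ g := by
    funext e x
    -- The object `f x` is recovered from `π(1, f)` as the presheaf at `x`.
    apply hF
    rw [← F.presheafAt_dist_restrict f, ← F.presheafAt_dist_restrict g, h]
  obtain ⟨obj, map, _, _⟩ := f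
  obtain ⟨obj', map', _, _⟩ := g
  dsimp only at hobj
  subst hobj
  -- Once the object parts coincide, equality of the restrictions says that `map` and `map'` have
  -- equal evaluations.
  have hact := eq_of_heq (VDist.mk.inj h).2.2
  have hmap : @map = @map' := by
    funext a b y y'
    refine (F.dist_isLiftAt (obj y) (obj y')).ext _ _ fun c x => ?_
    exact congrFun (congrFun (congrFun (congrFun (congrFun (congrFun hact c) a) b) x) y) y'
  subst hmap
  rfl

end LiftFamily

end

/-! ### Existence of presheaf categories and admissibility -/

theorem mainTheorem10 (V : VirtualBicategory.{w, v, t}) [V.Normal]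
    (P : DistClass.{max u w v t} V) (hP : P.PresheafInduced) (A : VCat.{max u w v t} V) :
    (P.HasPresheafObject A ↔
      ∀ ⦃e e' : V.Obj⦄ (p : Presheaf A e) (q : Presheaf A e'), P p → P q → HasRightLift q p) ∧
    (P.HasPresheafObject A → (P.Admissible A ↔ P.repletion A.idDist)) := by
  refine ⟨⟨?_, fun H => ?_⟩, fun h => ⟨fun h' => h'.2, fun h' => ⟨h, h'⟩⟩⟩
  · rintro ⟨Q, π, hπ⟩ e e' p q hp hq
    -- Both presheaves become restrictions of `π` along functors out of one-object categories;
    -- density then exhibits the hom-morphism of `Q` between the two chosen objects as their lift.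
    obtain ⟨f, rfl, -⟩ := hπ.existsUnique p hp
    obtain ⟨g, rfl, -⟩ := hπ.existsUnique q hq
    have h := hπ.dense.isLiftAt (f.obj StarOb.pt) (g.obj StarOb.pt)
    exact (hasRightLift_iff _ _).2 ⟨_, _, h.natural, h.exists_post, h.ext⟩
  · have H' : ∀ (e e' : V.Obj) (p : {p : Presheaf A e // P p}) (q : {q : Presheaf A e' // P q}),
        ∃ k ϖ, IsLiftAt p.1 StarOb.pt q.1 StarOb.pt k ϖ :=
      fun e e' p q => (hasRightLift_iff p.1 q.1).1 (H p.1 q.1 p.2 q.2)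
    choose k ϖ h using H'
    let F : LiftFamily A :=
      -- Presheaves on `A` again form a type in `max u w v t`, so they can be the objects of a
      -- `V`-category of the same size as `A`.
      { Ix := fun e => {p : Presheaf A e // P p}
        psh := fun p => p.1
        hom := fun p q => k _ _ p q
        ev := fun p q => ϖ _ _ p q
        isLiftAt := fun p q => h _ _ p q }
    refine ⟨F.cat, F.dist, F.dist_dense, fun X p hp => ?_, fun X f => ?_⟩
    · refine existsUnique_of_exists_of_unique ?_ fun f g hf hg =>
        F.functor_ext (fun {_ _ _} h => Subtype.ext h) (hf.symm.trans hg)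
      -- The classifying functor must send `x` to `p(1, x)`, which lies in `P` because `P` is
      -- presheaf-induced.
      let obj : ∀ {b : V.Obj}, X.Ob b → F.cat.Ob b := fun {b} x => ⟨p.presheafAt x, (hP p).1 hp x⟩
      have nat : ∀ {b b' : V.Obj} (y : X.Ob b) (y' : X.Ob b'),
          IsNatural F.dist (obj y) F.dist (obj y') (fun _ x => p.actR x y y') :=
        fun y y' _ _ x x' => p.actL_actR x x' y y'
      refine ⟨VFunctor.ofAction F.dist_isLiftAt obj (fun {_ _ _} x y y' => p.actR x y y')
        p.actR_one p.actR_mul nat, ?_⟩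
      refine VDist.ext rfl HEq.rfl (heq_of_eq ?_)
      funext a b b' x y y'
      -- The right action on the restriction of `F.dist` is the evaluation of `map`, which was
      -- defined so as to give back the action on `p`.
      exact ((F.dist_isLiftAt (obj y) (obj y')).post_desc _ (nat y y') x).symm
    -- The presheaves of a restriction of `F.dist` are objects of `F.cat`, hence in `P` by
    -- construction; the other half of presheaf-inducedness concludes.
    · refine (hP _).2 fun e x => ?_
      rw [F.presheafAt_dist_restrict]
      exact (f.obj x).2
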